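/- Let $\Omega\subset\mathbb R^2$ be a domain (open and connected), decomposed into finitely many pairwise disjoint subdomains $\Omega^{(k)}\subset\Omega$, $k=1,\dots,K$, with $\Omega\subset\bigcup_k\overline{\Omega^{(k)}}$. Each $\Omega^{(k)}$ is star-shaped with respect to a point $O_k$, namely $$\Omega^{(k)}=\{O_k+s(\cos\phi,\sin\phi):0\le s<r^{(k)}(\phi),\ 0\le\phi<2\pi\},$$ where $r^{(k)}:[0,2\pi]\to\mathbb R$ is continuous, piecewise $C^1$, satisfies $r^{(k)}(0)=r^{(k)}(2\pi)$, and $r^{(k)}\ge r_0$ for some $r_0>0$ not depending on $k$. Curvilinear coordinates in $\Omega^{(k)}$ are given by $$X^{(k)}(\rho,\phi)=O_k+e^{\rho}r^{(k)}(\phi)(\cos\phi,\sin\phi),\qquad \rho\in(-\infty,0],\ \phi\in[0,2\pi).$$ For each $k$ let $0=\varphi^{(k)}_0<\varphi^{(k)}_1<\dots<\varphi^{(k)}_{m'}=2\pi$ be a partition. Let $0<C_1\le C_2$, $\eta>0$, and let $f,z\in H^1(\Omega)^2$ ($f$ represents the Dirichlet data and $z$ the measured displacement). For $v\in L^1(\Omega)$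 put $$\mathrm{TV}(v)=\sup\Big\{\int_\Omega v\,\nabla\cdot w\,dx\,dy:\ w\in C^1_c(\Omega)^2,\ |w|\le1\text{ on }\Omega\Big\}.$$ Let $$\Lambda=\big\{(\mu,\lambda)\in L^\infty(\Omega)^2:\ C_1\le\mu,\lambda\le C_2\text{ a.e. in }\Omega,\ \mathrm{TV}(\mu)<\infty,\ \mathrm{TV}(\lambda)<\infty\big\},$$ and let $\Lambda_{h'}$ be the set of those $(\mu,\lambda)\in\Lambda$ for which, for all $k$ and $j=1,\dots,m'$, both $\mu$ and $\lambda$ are constant almost everywhere on the sector $X^{(k)}\big((-\infty,0]\times[\varphi^{(k)}_{j-1},\varphi^{(k)}_j)\big)$. For $\ell=(\mu,\lambda)\in\Lambda$ let $u[\ell]$ be the weak solution of $$-\nabla\cdot\big(2\mu\,\varepsilon(u)+\lambda(\nabla\cdot u)I\big)=0\ \text{ in }\Omega,\qquad u=f\ \text{ on }\partial\Omega,$$ that is, $u\in H^1(\Omega)^2$, $u-f\in H^1_0(\Omega)^2$ and $\int_\Omega\big(2\mu\,\varepsilon(u):\varepsilon(w)+\lambda(\nabla\cdot u)(\nabla\cdot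 w)\big)\,dx\,dy=0$ for all $w\in H^1_0(\Omega)^2$, where $\varepsilon(u)=\tfrac12(\nabla u+(\nabla u)^T)$. Let $$J(\ell)=\frac12\sum_{k=1}^{K}\sum_{j=1}^{m'}\int_{-\infty}^0\int_{\varphi^{(k)}_{j-1}}^{\varphi^{(k)}_j}\Big(2\mu\,|\varepsilon(u[\ell]-z)|^2+\lambda\,|\nabla\cdot(u[\ell]-z)|^2\Big)e^{2\rho}\,r^{(k)}(\phi)^2\,d\phi\,d\rho+\eta\big(\mathrm{TV}(\mu)+\mathrm{TV}(\lambda)\big),$$ where the functions in the $(k,j)$-th integrand are evaluated at $X^{(k)}(\rho,\phi)$ and $|\varepsilon|$ is the Frobenius norm. Then for every $\ell\in\Lambda_{h'}$ the weak solution $u[\ell]$ exists and is unique (up to equality a.e. in $\Omega$), so $J$ is well defined on $\Lambda_{h'}$; $J$ is finite on $\Lambda_{h'}$; and $J$ attains its minimum on $\Lambda_{h'}$: there is $\ell^0_{h'}\in\Lambda_{h'}$ with $J(\ell^0_{h'})\le J(\ell)$ for all $\ell\in\Lambda_{h'}$. -/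

import Mathlib

open MeasureTheory Set Filter Topology
open scoped ENNReal

/-- The Euclidean plane. -/
abbrev Plane : Type := EuclideanSpace ℝ (Fin 2)

namespace LameInverse

noncomputable section

/-! ### Sobolev spaces on an open set of the plane -/

/-- The classical partial derivative `∂ᵢ v` of a scalar function. -/
def classicalPartial (i : Fin 2) (v : Plane → ℝ) (x : Plane) : ℝ :=
  fderiv ℝ v x (EuclideanSpace.single i (1 : ℝ))

/-- Scalar test functions: elements of `C_c^∞(Ω)`. -/
def IsTestFunction (Ω : Set Plane) (ψ : Plane → ℝ) : Prop :=
  ContDiff ℝ ((⊤ : ℕ∞) : WithTop ℕ∞) ψ ∧ HasCompactSupport ψ ∧ tsupport ψ ⊆ Ω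

/-- `g` is a square integrable weak partial derivative `∂ᵢ v` of `v` on `Ω`. -/
def IsWeakPartial (Ω : Set Plane) (i : Fin 2) (v g : Plane → ℝ) : Prop :=
  MemLp g 2 (volume.restrict Ω) ∧
    ∀ ψ : Plane → ℝ, IsTestFunction Ω ψ →
      ∫ x in Ω, v x * classicalPartial i ψ x = - ∫ x in Ω, g x * ψ x

/-- `v ∈ H¹(Ω)`. -/
def MemH1 (Ω : Set Plane) (v : Plane → ℝ) : Prop :=
  MemLp v 2 (volume.restrict Ω) ∧ ∀ i : Fin 2, ∃ g : Plane → ℝ, IsWeakPartial Ω i v g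

/-- The weak partial derivative `∂ᵢ v` of `v ∈ H¹(Ω)`; it is unique up to a null subset of `Ω`
(an arbitrary function if there is no weak derivative). -/
def weakPartial (Ω : Set Plane) (i : Fin 2) (v : Plane → ℝ) : Plane → ℝ :=
  Classical.epsilon fun g : Plane → ℝ => IsWeakPartial Ω i v g

/-- `v ∈ H¹₀(Ω)`, the closure of `C_c^∞(Ω)` in `H¹(Ω)`. -/
def MemH1Zero (Ω : Set Plane) (v : Plane → ℝ) : Prop :=
  MemH1 Ω v ∧ ∃ ψ : ℕ → Plane → ℝ,
    (∀ n, IsTestFunction Ω (ψ n)) ∧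
    Tendsto (fun n => eLpNorm (fun x => v x - ψ n x) 2 (volume.restrict Ω)) atTop (𝓝 0) ∧
    ∀ i : Fin 2, Tendsto
      (fun n => eLpNorm (fun x => weakPartial Ω i v x - classicalPartial i (ψ n) x) 2
        (volume.restrict Ω)) atTop (𝓝 0)

/-- `v ∈ H¹(Ω)²`. -/
def MemH1Vec (Ω : Set Plane) (v : Plane → Plane) : Prop :=
  ∀ i : Fin 2, MemH1 Ω fun x => v x i

/-- `v ∈ H¹₀(Ω)²`. -/
def MemH1ZeroVec (Ω : Set Plane) (v : Plane → Plane) : Prop :=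
  ∀ i : Fin 2, MemH1Zero Ω fun x => v x i

/-! ### The forward problem of linear elasticity -/

/-- The strain tensor `ε(v) = (∇v + (∇v)ᵀ) / 2` of a displacement `v ∈ H¹(Ω)²`. -/
def strain (Ω : Set Plane) (v : Plane → Plane) (x : Plane) : Matrix (Fin 2) (Fin 2) ℝ :=
  Matrix.of fun i j =>
    (weakPartial Ω j (fun y => v y i) x + weakPartial Ω i (fun y => v y j) x) / 2

/-- The divergence `∇ · v` of `v ∈ H¹(Ω)²`. -/
def weakDiv (Ω : Set Plane) (v : Plane → Plane) (x : Plane) : ℝ :=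
  ∑ i : Fin 2, weakPartial Ω i (fun y => v y i) x

/-- A pair `ℓ = (μ, λ)` of Lamé coefficients. -/
abbrev LamePair : Type := (Plane → ℝ) × (Plane → ℝ)

/-- `u` is a weak solution of `-∇ · (2 μ ε(u) + λ (∇ · u) I) = 0` in `Ω`, `u = f` on `∂Ω`, where
`ℓ = (μ, λ)` and the boundary values are those of a field `f ∈ H¹(Ω)²`. For piecewise constant
coefficients the continuity of displacement and of traction across the material interfaces is
part of the weak formulation. -/
def IsWeakSolution (Ω : Set Plane) (ℓ : LamePair) (f u : Plane → Plane) : Prop :=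
  MemH1Vec Ω u ∧ MemH1ZeroVec Ω (fun x => u x - f x) ∧
    ∀ w : Plane → Plane, MemH1ZeroVec Ω w →
      ∫ x in Ω, (2 * ℓ.1 x * (∑ i, ∑ j, strain Ω u x i j * strain Ω w x i j)
        + ℓ.2 x * (weakDiv Ω u x * weakDiv Ω w x)) = 0

/-- The displacement field `u[ℓ]`: the weak solution of the forward problem with Lamé
coefficients `ℓ` and boundary values `f`. -/
def displacement (Ω : Set Plane) (f : Plane → Plane) (ℓ : LamePair) : Plane → Plane :=
  Classical.epsilon fun u : Plane → Plane => IsWeakSolution Ω ℓ f u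

/-! ### Total variation and the admissible coefficients -/

/-- Admissible fields for the total variation: `w ∈ C_c¹(Ω)²` with `|w| ≤ 1` on `Ω`. -/
def IsTVField (Ω : Set Plane) (w : Plane → Plane) : Prop :=
  ContDiff ℝ 1 w ∧ HasCompactSupport w ∧ tsupport w ⊆ Ω ∧ ∀ x ∈ Ω, ‖w x‖ ≤ 1

/-- The total variation of `v ∈ L¹(Ω)`, the supremum of `∫_Ω v (∇ · w)` over all admissible `w`.
As `w = 0` is admissible, cutting the integrals off at `0` does not change the supremum. -/
def totalVariation (Ω : Set Plane) (v : Plane → ℝ) : ℝ≥0∞ :=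
  ⨆ (w : Plane → Plane) (_ : IsTVField Ω w),
    ENNReal.ofReal (∫ x in Ω, v x * ∑ i : Fin 2, classicalPartial i (fun y => w y i) x)

/-- The set `Λ`: pairs in `L^∞(Ω) × L^∞(Ω)` with values in `[C₁, C₂]` almost everywhere in `Ω` and
with finite total variation. -/
def admissible (Ω : Set Plane) (C₁ C₂ : ℝ) : Set LamePair :=
  {ℓ | MemLp ℓ.1 ⊤ (volume.restrict Ω) ∧ MemLp ℓ.2 ⊤ (volume.restrict Ω) ∧
    (∀ᵐ x ∂volume.restrict Ω, ℓ.1 x ∈ Icc C₁ C₂) ∧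
    (∀ᵐ x ∂volume.restrict Ω, ℓ.2 x ∈ Icc C₁ C₂) ∧
    totalVariation Ω ℓ.1 < ⊤ ∧ totalVariation Ω ℓ.2 < ⊤}

/-! ### Star-shaped decomposition and curvilinear coordinates -/

/-- `r` is continuous on `[a, b]` and `C¹`, up to the end points, between the consecutive points
of some finite set of break points. -/
def IsPiecewiseC1On (r : ℝ → ℝ) (a b : ℝ) : Prop :=
  ContinuousOn r (Icc a b) ∧ ∃ S : Finset ℝ, ∀ c d : ℝ, a ≤ c → c < d → d ≤ b →
    (∀ s ∈ S, s ∉ Ioo c d) → ContDiffOn ℝ 1 r (Icc c d)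

/-- The unit vector `(cos φ, sin φ)`. -/
def direction (φ : ℝ) : Plane := !₂[Real.cos φ, Real.sin φ]

/-- The curvilinear coordinates `(ρ, φ) ↦ O + e^ρ r(φ) (cos φ, sin φ)` around `O`. -/
def curvilinear (O : Plane) (r : ℝ → ℝ) (ρ φ : ℝ) : Plane :=
  O + (Real.exp ρ * r φ) • direction φ

/-- The region `{O + s (cos φ, sin φ) : 0 ≤ s < r(φ), 0 ≤ φ < 2π}`, star-shaped with respect to
`O`. -/
def starRegion (O : Plane) (r : ℝ → ℝ) : Set Plane :=
  {x | ∃ s φ : ℝ, 0 ≤ s ∧ s < r φ ∧ φ ∈ Ico 0 (2 * Real.pi) ∧ x = O + s • direction φ}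

/-- A decomposition of `Ω` into `K` non-overlapping subdomains, the `k`-th one star-shaped with
respect to the singular point `center k` and bounded by the curve
`φ ↦ center k + radius k φ • (cos φ, sin φ)`. -/
structure StarDecomposition (Ω : Set Plane) (K : ℕ) where
  center : Fin K → Plane
  radius : Fin K → ℝ → ℝ
  radius_piecewiseC1 : ∀ k, IsPiecewiseC1On (radius k) 0 (2 * Real.pi)
  radius_closed : ∀ k, radius k 0 = radius k (2 * Real.pi)
  radius_pos : ∃ r₀ : ℝ, 0 < r₀ ∧ ∀ k, ∀ φ ∈ Icc 0 (2 * Real.pi), r₀ ≤ radius k φ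
  disjoint : Pairwise fun k l =>
    Disjoint (starRegion (center k) (radius k)) (starRegion (center l) (radius l))
  subset : ∀ k, starRegion (center k) (radius k) ⊆ Ω
  cover : Ω ⊆ ⋃ k, closure (starRegion (center k) (radius k))

/-- A partition `0 = φ₀ < φ₁ < ⋯ < φ_m = 2π` of the angular interval. -/
structure AngularMesh (m : ℕ) where
  node : Fin (m + 1) → ℝ
  strictMono : StrictMono node
  first : node 0 = 0
  last : node (Fin.last m) = 2 * Real.pi

/-- The `j`-th angular sector of the `k`-th subdomain: the points with coordinates
`(ρ, φ) ∈ (-∞, 0] × [φ_{j-1}, φ_j)` (with `j` counted from `1`). -/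
def sector {Ω : Set Plane} {K m : ℕ} (D : StarDecomposition Ω K) (mesh : Fin K → AngularMesh m)
    (k : Fin K) (j : Fin m) : Set Plane :=
  {x | ∃ ρ φ : ℝ, ρ ∈ Iic 0 ∧ φ ∈ Ico ((mesh k).node j.castSucc) ((mesh k).node j.succ) ∧
    x = curvilinear (D.center k) (D.radius k) ρ φ}

/-- The discrete set `Λ_{h'}`: the pairs in `Λ` whose two members are constant almost everywhere
on each angular sector of each subdomain. -/
def discreteAdmissible {Ω : Set Plane} {K m : ℕ} (D : StarDecomposition Ω K)
    (mesh : Fin K → AngularMesh m) (C₁ C₂ : ℝ) : Set LamePair :=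
  {ℓ | ℓ ∈ admissible Ω C₁ C₂ ∧ ∀ (k : Fin K) (j : Fin m),
    (∃ c : ℝ, ∀ᵐ x ∂volume.restrict (sector D mesh k j), ℓ.1 x = c) ∧
    (∃ c : ℝ, ∀ᵐ x ∂volume.restrict (sector D mesh k j), ℓ.2 x = c)}

/-! ### The discrete energy functional -/

/-- The energy density `2 μ |ε(v)|² + λ |∇ · v|²`, with the Frobenius norm of `ε(v)`. -/
def energyDensity (Ω : Set Plane) (ℓ : LamePair) (v : Plane → Plane) (x : Plane) : ℝ :=
  2 * ℓ.1 x * (∑ i, ∑ j, strain Ω v x i j ^ 2) + ℓ.2 x * weakDiv Ω v x ^ 2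

/-- The discrete functional `J`: the misfit between `u[ℓ]` and the data `z` in the energy norm,
written in the curvilinear coordinates of the subdomains, where `dx dy = e^{2ρ} r(φ)² dφ dρ`, plus
`η` times the total variation. The integrand is nonnegative, and the value may be `∞` a priori. -/
def discreteEnergy {Ω : Set Plane} {K m : ℕ} (D : StarDecomposition Ω K)
    (mesh : Fin K → AngularMesh m) (η : ℝ) (f z : Plane → Plane) (ℓ : LamePair) : ℝ≥0∞ :=
  2⁻¹ * (∑ k : Fin K, ∑ j : Fin m, ∫⁻ ρ in Iic (0 : ℝ),
      ∫⁻ φ in Ico ((mesh k).node j.castSucc) ((mesh k).node j.succ),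
        ENNReal.ofReal
          (energyDensity Ω ℓ (fun x => displacement Ω f ℓ x - z x)
              (curvilinear (D.center k) (D.radius k) ρ φ)
            * (Real.exp (2 * ρ) * D.radius k φ ^ 2)))
    + ENNReal.ofReal η * (totalVariation Ω ℓ.1 + totalVariation Ω ℓ.2)

end

end LameInverse

/-!
The discrete admissible set is finite-dimensional: a pair in it is determined, up to a null set of
`Ω`, by one constant in `[C₁, C₂]` per sector and coefficient, because the sectors exhaust `Ω` up to
the finitely many singular points (`StarDecomposition.ae_mem_sector`). The constants of a minimizing
sequence therefore converge along a subsequence, and then the coefficients themselves converge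
uniformly, up to null sets, to a piecewise constant pair (`exists_limit_coeff`). It remains to see
that the functional is lower semicontinuous under this convergence.

The total variation is a supremum of functionals that are continuous under bounded convergence
(`totalVariation_le_liminf`). This also shows that the limit has finite total variation, so nothing
has to be known about the perimeters of the sectors.

For the misfit, `H¹(Ω)` is encoded by jets `(v, ∂₁ v, ∂₂ v)` in a product of copies of `L²(Ω)`, in
which `H¹₀(Ω)` is a closed subspace (`memH1Zero_iff`). On this subspace the elastic form is coercive,
uniformly in the admissible coefficients: Korn's first inequality follows from
`∫ ∂ᵢv ∂ⱼw = ∫ ∂ⱼv ∂ᵢw`, and Poincaré's inequality holds because `Ω`, covered by finitely many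
bounded sets, is bounded (`elasticForm_coercive`). The Lax–Milgram theorem gives existence and
uniqueness of the displacement, and the energy estimate for the difference of two solutions shows
that uniformly convergent coefficients have displacements converging in `H¹(Ω)²`
(`tendsto_vecJet_displacement`). Along a subsequence the energy densities converge almost everywhere,
and Fatou's lemma bounds the misfit of the limit. To apply it to the iterated integrals in
curvilinear coordinates, and to see that they do not depend on the representatives of the weak
derivatives and are finite, it suffices that such an integral of a nonnegative function is at most
twice its integral over `Ω` (`curvIntegral_le_of_measurable`).
-/

namespace LameInverse

noncomputable section

/-! ### Calculus of test functions -/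

namespace IsTestFunction

variable {Ω : Set Plane} {φ ψ : Plane → ℝ}

theorem differentiable (hψ : IsTestFunction Ω ψ) : Differentiable ℝ ψ :=
  hψ.1.differentiable (by simp)

theorem partialDeriv (hψ : IsTestFunction Ω ψ) (i : Fin 2) :
    IsTestFunction Ω (classicalPartial i ψ) := by
  have hsub : tsupport (classicalPartial i ψ) ⊆ tsupport ψ := by
    refine closure_minimal (fun x hx => ?_) (isClosed_tsupport ψ)
    refine tsupport_fderiv_subset ℝ (f := ψ) (subset_tsupport _ ?_)
    intro h
    exact hx (by simp [classicalPartial, h])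
  refine ⟨?_, hψ.2.1.of_isClosed_subset (isClosed_tsupport _) hsub, hsub.trans hψ.2.2⟩
  exact (hψ.1.fderiv_right (m := ((⊤ : ℕ∞) : WithTop ℕ∞)) (by simp)).clm_apply contDiff_const

theorem zero : IsTestFunction Ω (0 : Plane → ℝ) :=
  ⟨contDiff_const, HasCompactSupport.zero, by simp⟩

theorem add (hφ : IsTestFunction Ω φ) (hψ : IsTestFunction Ω ψ) : IsTestFunction Ω (φ + ψ) :=
  ⟨hφ.1.add hψ.1, hφ.2.1.add hψ.2.1,
    (tsupport_add φ ψ).trans (union_subset hφ.2.2 hψ.2.2)⟩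

theorem const_smul (c : ℝ) (hψ : IsTestFunction Ω ψ) : IsTestFunction Ω (c • ψ) := by
  have hsub : tsupport (c • ψ) ⊆ tsupport ψ :=
    closure_mono (Function.support_const_smul_subset c ψ)
  exact ⟨contDiff_const.smul hψ.1,
    hψ.2.1.of_isClosed_subset (isClosed_tsupport _) hsub, hsub.trans hψ.2.2⟩

theorem integrable_mul (hψ : IsTestFunction Ω ψ) {g : Plane → ℝ} (hg : Continuous g) :
    Integrable fun x => g x * ψ x :=
  (hg.mul hψ.1.continuous).integrable_of_hasCompactSupport hψ.2.1.mul_left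

theorem memLp (hψ : IsTestFunction Ω ψ) (p : ℝ≥0∞) : MemLp ψ p (volume.restrict Ω) :=
  (hψ.1.continuous.memLp_of_hasCompactSupport hψ.2.1).restrict Ω

/-- Integrals against a test function only see `Ω`. -/
theorem setIntegral_mul (hψ : IsTestFunction Ω ψ) (g : Plane → ℝ) :
    ∫ x in Ω, g x * ψ x = ∫ x, g x * ψ x :=
  setIntegral_eq_integral_of_forall_compl_eq_zero fun x hx => by
    rw [image_eq_zero_of_notMem_tsupport fun h => hx (hψ.2.2 h), mul_zero]

/-- Integration by parts against a test function, on the whole plane. -/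
theorem integral_mul_partialDeriv (hψ : IsTestFunction Ω ψ) (i : Fin 2) {g : Plane → ℝ}
    (hg : ContDiff ℝ 1 g) :
    ∫ x, g x * classicalPartial i ψ x = - ∫ x, classicalPartial i g x * ψ x := by
  have hg' : Continuous (classicalPartial i g) :=
    (hg.continuous_fderiv (by simp)).clm_apply continuous_const
  exact integral_mul_fderiv_eq_neg_fderiv_mul_of_integrable
    (hψ.integrable_mul hg') ((hψ.partialDeriv i).integrable_mul hg.continuous)
    (hψ.integrable_mul hg.continuous) (fun x _ => hg.differentiable (by simp) x)
    (fun x _ => hψ.differentiable x)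

theorem contDiff_one (hψ : IsTestFunction Ω ψ) : ContDiff ℝ 1 ψ :=
  hψ.1.of_le (by exact_mod_cast le_top)

theorem isWeakPartial (hψ : IsTestFunction Ω ψ) (i : Fin 2) :
    IsWeakPartial Ω i ψ (classicalPartial i ψ) := by
  refine ⟨(hψ.partialDeriv i).memLp 2, fun χ hχ => ?_⟩
  rw [(hχ.partialDeriv i).setIntegral_mul, hχ.setIntegral_mul,
    hχ.integral_mul_partialDeriv i hψ.contDiff_one]

theorem partialDeriv_comm (hψ : IsTestFunction Ω ψ) (i j : Fin 2) :
    classicalPartial i (classicalPartial j ψ) = classicalPartial j (classicalPartial i ψ) := by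
  have key : ∀ (i j : Fin 2) (x : Plane), classicalPartial i (classicalPartial j ψ) x
      = fderiv ℝ (fderiv ℝ ψ) x (EuclideanSpace.single i 1) (EuclideanSpace.single j 1) := by
    intro i j x
    have hd : DifferentiableAt ℝ (fderiv ℝ ψ) x :=
      ((hψ.1.fderiv_right (m := 1) (WithTop.coe_le_coe.2 (le_top : (2 : ℕ∞) ≤ ⊤))).differentiable (by simp)) x
    have : HasFDerivAt (classicalPartial j ψ) _ x :=
      hd.hasFDerivAt.clm_apply (hasFDerivAt_const (EuclideanSpace.single j (1 : ℝ)) x)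
    rw [classicalPartial, this.fderiv]
    simp
  funext x
  rw [key, key]
  have hs : IsSymmSndFDerivAt ℝ ψ x := by
    refine hψ.1.contDiffAt.isSymmSndFDerivAt ?_
    simp only [minSmoothness_of_isRCLikeNormedField]
    exact WithTop.coe_le_coe.2 (le_top : (2 : ℕ∞) ≤ ⊤)
  exact hs _ _

/-- Mixed partial derivatives of test functions can be exchanged under the integral. This is the
identity behind Korn's first inequality. -/
theorem integral_partialDeriv_mul_comm (hφ : IsTestFunction Ω φ) (hψ : IsTestFunction Ω ψ)
    (i j : Fin 2) :
    ∫ x, classicalPartial i φ x * classicalPartial j ψ x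
      = ∫ x, classicalPartial j φ x * classicalPartial i ψ x := by
  rw [hψ.integral_mul_partialDeriv j (hφ.partialDeriv i).contDiff_one,
    hψ.integral_mul_partialDeriv i (hφ.partialDeriv j).contDiff_one, hφ.partialDeriv_comm i j]

/-- Integrating `∂ᵢ(xᵢ ψ²)` over the plane gives `∫ ψ² = -2 ∫ xᵢ ψ ∂ᵢψ`. -/
theorem integral_sq (hψ : IsTestFunction Ω ψ) (i : Fin 2) :
    ∫ x, ψ x * ψ x = ∫ x, (-2 * x i * ψ x) * classicalPartial i ψ x := by
  have hc : ContDiff ℝ 1 fun x : Plane => x i := by fun_prop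
  have h := hψ.integral_mul_partialDeriv i (hc.mul hψ.contDiff_one)
  have hpart : ∀ x, classicalPartial i (fun x : Plane => x i * ψ x) x
      = x i * classicalPartial i ψ x + ψ x := by
    intro x
    have h1 : HasFDerivAt (fun x : Plane => x i) (EuclideanSpace.proj i : Plane →L[ℝ] ℝ) x :=
      (EuclideanSpace.proj i : Plane →L[ℝ] ℝ).hasFDerivAt
    have h2 := h1.mul (hψ.differentiable x).hasFDerivAt
    rw [classicalPartial]
    erw [h2.fderiv]
    simp [classicalPartial]
  simp only [hpart] at h
  have i1 : Integrable fun x => (x i * classicalPartial i ψ x) * ψ x :=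
    hψ.integrable_mul (hc.continuous.mul (hψ.partialDeriv i).1.continuous)
  have i2 : Integrable fun x => ψ x * ψ x := hψ.integrable_mul hψ.1.continuous
  simp only [add_mul] at h
  rw [integral_add i1 i2] at h
  have e : ∫ x, (x i * ψ x) * classicalPartial i ψ x
      = ∫ x, (x i * classicalPartial i ψ x) * ψ x := by
    congr 1; funext x; ring
  have e2 : ∫ x, (-2 * x i * ψ x) * classicalPartial i ψ x
      = -2 * ∫ x, (x i * ψ x) * classicalPartial i ψ x := by
    rw [← integral_const_mul]; congr 1; funext x; ring
  rw [e2]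
  linarith

end IsTestFunction

/-! ### Weak derivatives -/

section Weak

variable {Ω : Set Plane} {i : Fin 2} {v w g h : Plane → ℝ}

theorem integrable_mul_of_memLp_two {μ : Measure Plane} (hv : MemLp v 2 μ) (hw : MemLp w 2 μ) :
    Integrable (fun x => v x * w x) μ := hv.integrable_mul hw

theorem IsWeakPartial.ae_eq (hΩ : IsOpen Ω) (hg : IsWeakPartial Ω i v g)
    (hh : IsWeakPartial Ω i v h) : g =ᵐ[volume.restrict Ω] h := by
  have hgh : MemLp (g - h) 2 (volume.restrict Ω) := hg.1.sub hh.1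
  have hloc : LocallyIntegrableOn (g - h) Ω :=
    locallyIntegrableOn_of_locallyIntegrable_restrict (hgh.locallyIntegrable one_le_two)
  have := hΩ.ae_eq_zero_of_integral_contDiff_smul_eq_zero hloc (fun ψ h1 h2 h3 => ?_)
  · rw [Filter.EventuallyEq, ae_restrict_iff' hΩ.measurableSet]
    filter_upwards [this] with x hx hxΩ
    exact sub_eq_zero.1 (hx hxΩ)
  · have hψ : IsTestFunction Ω ψ := ⟨h1, h2, h3⟩
    have e1 := hg.2 ψ hψ
    have e2 := hh.2 ψ hψ
    have : ∫ x, ψ x • (g - h) x = ∫ x in Ω, (g x * ψ x - h x * ψ x) := by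
      have := hψ.setIntegral_mul (g - h)
      rw [← integral_congr_ae (ae_of_all _ fun x => ?_), ← this]
      · congr 1; funext x; simp [sub_mul]
      · simp [mul_comm]
    rw [this, integral_sub (integrable_mul_of_memLp_two hg.1 (hψ.memLp 2)) (integrable_mul_of_memLp_two hh.1 (hψ.memLp 2))]
    linarith

theorem IsWeakPartial.sub (hv : MemLp v 2 (volume.restrict Ω)) (hw : MemLp w 2 (volume.restrict Ω))
    (hg : IsWeakPartial Ω i v g) (hh : IsWeakPartial Ω i w h) :
    IsWeakPartial Ω i (fun x => v x - w x) (fun x => g x - h x) := by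
  refine ⟨hg.1.sub hh.1, fun ψ hψ => ?_⟩
  have e1 := hg.2 ψ hψ
  have e2 := hh.2 ψ hψ
  have hψ' := (hψ.partialDeriv i).memLp 2
  simp only [sub_mul]
  rw [integral_sub (integrable_mul_of_memLp_two hv hψ') (integrable_mul_of_memLp_two hw hψ'),
    integral_sub (integrable_mul_of_memLp_two hg.1 (hψ.memLp 2)) (integrable_mul_of_memLp_two hh.1 (hψ.memLp 2)), e1, e2]
  ring

theorem IsWeakPartial.add (hv : MemLp v 2 (volume.restrict Ω)) (hw : MemLp w 2 (volume.restrict Ω))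
    (hg : IsWeakPartial Ω i v g) (hh : IsWeakPartial Ω i w h) :
    IsWeakPartial Ω i (fun x => v x + w x) (fun x => g x + h x) := by
  refine ⟨hg.1.add hh.1, fun ψ hψ => ?_⟩
  have e1 := hg.2 ψ hψ
  have e2 := hh.2 ψ hψ
  have hψ' := (hψ.partialDeriv i).memLp 2
  simp only [add_mul]
  rw [integral_add (integrable_mul_of_memLp_two hv hψ') (integrable_mul_of_memLp_two hw hψ'),
    integral_add (integrable_mul_of_memLp_two hg.1 (hψ.memLp 2)) (integrable_mul_of_memLp_two hh.1 (hψ.memLp 2)), e1, e2]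
  ring

theorem MemH1.isWeakPartial (hv : MemH1 Ω v) (i : Fin 2) :
    IsWeakPartial Ω i v (weakPartial Ω i v) :=
  Classical.epsilon_spec (hv.2 i)

theorem IsWeakPartial.weakPartial_ae_eq (hΩ : IsOpen Ω) (hg : IsWeakPartial Ω i v g) :
    weakPartial Ω i v =ᵐ[volume.restrict Ω] g :=
  IsWeakPartial.ae_eq hΩ (Classical.epsilon_spec ⟨g, hg⟩) hg

theorem MemH1.sub (hv : MemH1 Ω v) (hw : MemH1 Ω w) : MemH1 Ω fun x => v x - w x :=
  ⟨hv.1.sub hw.1, fun i =>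
    ⟨_, IsWeakPartial.sub hv.1 hw.1 (hv.isWeakPartial i) (hw.isWeakPartial i)⟩⟩

theorem MemH1.add (hv : MemH1 Ω v) (hw : MemH1 Ω w) : MemH1 Ω fun x => v x + w x :=
  ⟨hv.1.add hw.1, fun i =>
    ⟨_, IsWeakPartial.add hv.1 hw.1 (hv.isWeakPartial i) (hw.isWeakPartial i)⟩⟩

end Weak

/-! ### Jets of Sobolev functions as elements of a Hilbert space -/

/-- The Hilbert space `L²(Ω)`. -/
abbrev SqInt (Ω : Set Plane) : Type := Lp ℝ 2 (volume.restrict Ω)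

/-- Triples `(v, g₁, g₂)` of elements of `L²(Ω)`; `H¹(Ω)` sits inside as the triples with
`gᵢ = ∂ᵢ v`. The entry at `none` is the value, the one at `some i` the `i`-th derivative. -/
abbrev Jet (Ω : Set Plane) : Type := PiLp 2 fun _ : Option (Fin 2) => SqInt Ω

section

variable {Ω : Set Plane} {v w : Plane → ℝ}

theorem SqInt.inner_eq (f g : SqInt Ω) : inner ℝ f g = ∫ x in Ω, f x * g x := by
  rw [MeasureTheory.L2.inner_def]
  congr 1
  funext x
  simp [mul_comm]

/-- The jet `(v, ∂₁ v, ∂₂ v)` of `v ∈ H¹(Ω)`. -/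
def jet (hv : MemH1 Ω v) : Jet Ω :=
  WithLp.toLp 2 fun a => match a with
    | none => hv.1.toLp v
    | some i => (hv.isWeakPartial i).1.toLp _

theorem jet_none (hv : MemH1 Ω v) : jet hv none =ᵐ[volume.restrict Ω] v := hv.1.coeFn_toLp

theorem jet_some (hv : MemH1 Ω v) (i : Fin 2) :
    jet hv (some i) =ᵐ[volume.restrict Ω] weakPartial Ω i v :=
  (hv.isWeakPartial i).1.coeFn_toLp

theorem jet_eq (hΩ : IsOpen Ω) (hv : MemH1 Ω v) {F : Jet Ω}
    (h0 : F none =ᵐ[volume.restrict Ω] v) (hF : ∀ i, IsWeakPartial Ω i v (F (some i))) :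
    jet hv = F := by
  refine PiLp.ext fun a => Lp.ext ?_
  match a with
  | none => exact (jet_none hv).trans h0.symm
  | some i => exact (jet_some hv i).trans ((hF i).weakPartial_ae_eq hΩ)

theorem jet_sub (hΩ : IsOpen Ω) (hv : MemH1 Ω v) (hw : MemH1 Ω w) :
    jet (hv.sub hw) = jet hv - jet hw := by
  refine PiLp.ext fun a => Lp.ext ?_
  rw [PiLp.sub_apply]
  match a with
  | none =>
    filter_upwards [jet_none (hv.sub hw), jet_none hv, jet_none hw,
      Lp.coeFn_sub (jet hv none) (jet hw none)] with x h1 h2 h3 h4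
    rw [h1, h4, Pi.sub_apply, h2, h3]
  | some i =>
    have h := IsWeakPartial.sub hv.1 hw.1 (hv.isWeakPartial i) (hw.isWeakPartial i)
    filter_upwards [jet_some (hv.sub hw) i, jet_some hv i, jet_some hw i,
      Lp.coeFn_sub (jet hv (some i)) (jet hw (some i)), h.weakPartial_ae_eq hΩ]
      with x h1 h2 h3 h4 h5
    rw [h1, h4, Pi.sub_apply, h2, h3, h5]

variable (Ω) in
/-- The jets of the test functions on `Ω`. -/
def testJets : Submodule ℝ (Jet Ω) where
  carrier := {F | ∃ ψ, IsTestFunction Ω ψ ∧ F none =ᵐ[volume.restrict Ω] ψ ∧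
    ∀ i, F (some i) =ᵐ[volume.restrict Ω] classicalPartial i ψ}
  zero_mem' := by
    refine ⟨0, .zero, Lp.coeFn_zero _ _ _, fun i => (Lp.coeFn_zero _ _ _).trans ?_⟩
    filter_upwards with x
    simp [classicalPartial]
  add_mem' := by
    rintro F G ⟨φ, hφ, hF, hF'⟩ ⟨ψ, hψ, hG, hG'⟩
    refine ⟨φ + ψ, hφ.add hψ, ?_, fun i => ?_⟩
    · exact (Lp.coeFn_add (F none) (G none)).trans (hF.add hG)
    · filter_upwards [Lp.coeFn_add (F (some i)) (G (some i)), hF' i, hG' i] with x h1 h2 h3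
      rw [PiLp.add_apply, h1, Pi.add_apply, h2, h3, classicalPartial, classicalPartial,
        classicalPartial, fderiv_add (hφ.differentiable x) (hψ.differentiable x),
        add_apply]
  smul_mem' := by
    rintro c F ⟨φ, hφ, hF, hF'⟩
    refine ⟨c • φ, hφ.const_smul c, ?_, fun i => ?_⟩
    · exact (Lp.coeFn_smul c (F none)).trans (hF.const_smul c)
    · filter_upwards [Lp.coeFn_smul c (F (some i)), hF' i] with x h1 h2
      rw [PiLp.smul_apply, h1, Pi.smul_apply, h2, classicalPartial, classicalPartial,
        fderiv_const_smul (hφ.differentiable x), smul_apply]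

variable (Ω) in
/-- The jets of the elements of `H¹₀(Ω)`. -/
def zeroJets : Submodule ℝ (Jet Ω) := (testJets Ω).topologicalClosure

theorem isClosed_zeroJets : IsClosed (zeroJets Ω : Set (Jet Ω)) :=
  Submodule.isClosed_topologicalClosure _

theorem IsTestFunction.exists_jet {ψ : Plane → ℝ} (hψ : IsTestFunction Ω ψ) :
    ∃ F ∈ testJets Ω, F none =ᵐ[volume.restrict Ω] ψ ∧
      ∀ i, F (some i) =ᵐ[volume.restrict Ω] classicalPartial i ψ := by
  let F : Jet Ω := WithLp.toLp 2 fun a => match a with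
    | none => (hψ.memLp 2).toLp ψ
    | some i => ((hψ.partialDeriv i).memLp 2).toLp _
  have h0 : F none =ᵐ[volume.restrict Ω] ψ := (hψ.memLp 2).coeFn_toLp
  have h1 : ∀ i, F (some i) =ᵐ[volume.restrict Ω] classicalPartial i ψ :=
    fun i => ((hψ.partialDeriv i).memLp 2).coeFn_toLp
  exact ⟨F, ⟨ψ, hψ, h0, h1⟩, h0, h1⟩

@[fun_prop]
theorem continuous_jet_apply (a : Option (Fin 2)) : Continuous fun F : Jet Ω => F a :=
  PiLp.continuous_apply 2 _ a

theorem tendsto_jet_iff {F : ℕ → Jet Ω} {G : Jet Ω} :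
    Tendsto F atTop (𝓝 G) ↔ ∀ a, Tendsto (fun n => F n a) atTop (𝓝 (G a)) := by
  rw [(PiLp.homeomorph 2 fun _ : Option (Fin 2) => SqInt Ω).isInducing.tendsto_nhds_iff,
    tendsto_pi_nhds]
  rfl

/-- A property of jets that is closed and holds for test functions holds on `H¹₀(Ω)`. -/
theorem zeroJets_induction {P : Jet Ω → Prop} (hP : IsClosed {F | P F})
    (h : ∀ F ∈ testJets Ω, P F) {F : Jet Ω} (hF : F ∈ zeroJets Ω) : P F :=
  closure_minimal (s := (testJets Ω : Set (Jet Ω))) (t := {F | P F}) h hP hF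

/-- `∫ ∂ᵢv ∂ⱼw = ∫ ∂ⱼv ∂ᵢw` for `v, w ∈ H¹₀(Ω)`. -/
theorem inner_zeroJets_comm {F G : Jet Ω} (hF : F ∈ zeroJets Ω) (hG : G ∈ zeroJets Ω)
    (i j : Fin 2) :
    inner ℝ (F (some i)) (G (some j)) = inner ℝ (F (some j)) (G (some i)) := by
  refine zeroJets_induction (P := fun F => inner ℝ (F (some i)) (G (some j))
    = inner ℝ (F (some j)) (G (some i))) (isClosed_eq (by fun_prop) (by fun_prop)) ?_ hF
  rintro F ⟨φ, hφ, -, hF⟩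
  refine zeroJets_induction (P := fun G => inner ℝ (F (some i)) (G (some j))
    = inner ℝ (F (some j)) (G (some i))) (isClosed_eq (by fun_prop) (by fun_prop)) ?_ hG
  rintro G ⟨ψ, hψ, -, hG⟩
  have key : ∀ i j, inner ℝ (F (some i)) (G (some j))
      = ∫ x, classicalPartial i φ x * classicalPartial j ψ x := by
    intro i j
    rw [SqInt.inner_eq, ← (hψ.partialDeriv j).setIntegral_mul]
    refine integral_congr_ae ?_
    filter_upwards [hF i, hG j] with x h1 h2
    rw [h1, h2]
  rw [key, key, hφ.integral_partialDeriv_mul_comm hψ]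

/-- **Poincaré's inequality** on a domain contained in the strip `|xᵢ| ≤ R`. -/
theorem norm_zeroJets_le {R : ℝ} {i : Fin 2} (hR : ∀ x ∈ Ω, |x i| ≤ R) (hR0 : 0 ≤ R)
    (hΩ : IsOpen Ω) {F : Jet Ω} (hF : F ∈ zeroJets Ω) :
    ‖F none‖ ≤ 2 * R * ‖F (some i)‖ := by
  refine zeroJets_induction (P := fun F => ‖F none‖ ≤ 2 * R * ‖F (some i)‖)
    (isClosed_le (by fun_prop) (by fun_prop)) ?_ hF
  rintro F ⟨ψ, hψ, h0, h1⟩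
  have hm : MemLp (fun x : Plane => -2 * x i * ψ x) 2 (volume.restrict Ω) := by
    have hc : Continuous fun x : Plane => -2 * x i := by fun_prop
    exact ((hc.mul hψ.1.continuous).memLp_of_hasCompactSupport hψ.2.1.mul_left).restrict Ω
  have e : inner ℝ (F none) (F none) = inner ℝ (hm.toLp _) (F (some i)) := by
    rw [SqInt.inner_eq, SqInt.inner_eq]
    have e1 : ∫ x in Ω, (F none) x * (F none) x = ∫ x in Ω, ψ x * ψ x :=
      integral_congr_ae (by filter_upwards [h0] with x h; rw [h])
    have e2 : ∫ x in Ω, (hm.toLp _) x * (F (some i)) x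
        = ∫ x in Ω, (-2 * x i * ψ x) * classicalPartial i ψ x :=
      integral_congr_ae (by filter_upwards [hm.coeFn_toLp, h1 i] with x h h'; rw [h, h'])
    rw [e1, e2, hψ.setIntegral_mul, (hψ.partialDeriv i).setIntegral_mul, hψ.integral_sq i]
  have hn : ‖hm.toLp _‖ ≤ 2 * R * ‖F none‖ := by
    refine Lp.norm_le_mul_norm_of_ae_le_mul ?_
    filter_upwards [hm.coeFn_toLp, h0, ae_restrict_mem hΩ.measurableSet] with x h h' hx
    rw [h, h', norm_mul, norm_mul]
    have := hR x hx
    have h2 : ‖(-2 : ℝ)‖ = 2 := by norm_num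
    rw [h2, Real.norm_eq_abs (x i)]
    gcongr
  rw [real_inner_self_eq_norm_mul_norm] at e
  have hcs := real_inner_le_norm (hm.toLp _) (F (some i))
  rcases (norm_nonneg (F none)).eq_or_lt with h | h
  · rw [← h]; positivity
  · refine le_of_mul_le_mul_left ?_ h
    calc ‖F none‖ * ‖F none‖ ≤ ‖hm.toLp _‖ * ‖F (some i)‖ := e ▸ hcs
      _ ≤ (2 * R * ‖F none‖) * ‖F (some i)‖ := by gcongr
      _ = _ := by ring

theorem isWeakPartial_of_mem_zeroJets {F : Jet Ω} (hF : F ∈ zeroJets Ω) (i : Fin 2) :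
    IsWeakPartial Ω i (F none) (F (some i)) := by
  refine ⟨Lp.memLp _, fun χ hχ => ?_⟩
  have hχ0 := hχ.memLp (Ω := Ω) 2
  have hχ1 := (hχ.partialDeriv i).memLp (Ω := Ω) 2
  have key : ∀ f : SqInt Ω, ∀ g : Plane → ℝ, ∀ hg : MemLp g 2 (volume.restrict Ω),
      ∫ x in Ω, f x * g x = inner ℝ f (hg.toLp g) := by
    intro f g hg
    rw [SqInt.inner_eq]
    exact integral_congr_ae (by filter_upwards [hg.coeFn_toLp] with x h; rw [h])
  rw [key _ _ hχ1, key _ _ hχ0]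
  refine zeroJets_induction (P := fun F : Jet Ω => inner ℝ (F none) (hχ1.toLp _)
    = - inner ℝ (F (some i)) (hχ0.toLp _)) (isClosed_eq (by fun_prop) (by fun_prop)) ?_ hF
  rintro F ⟨ψ, hψ, h0, h1⟩
  rw [← key _ _ hχ1, ← key _ _ hχ0]
  have e1 : ∫ x in Ω, (F none) x * classicalPartial i χ x
      = ∫ x in Ω, ψ x * classicalPartial i χ x :=
    integral_congr_ae (by filter_upwards [h0] with x h; rw [h])
  have e2 : ∫ x in Ω, (F (some i)) x * χ x = ∫ x in Ω, classicalPartial i ψ x * χ x :=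
    integral_congr_ae (by filter_upwards [h1 i] with x h; rw [h])
  rw [e1, e2]
  exact (hψ.isWeakPartial i).2 χ hχ

theorem memH1_of_mem_zeroJets {F : Jet Ω} (hF : F ∈ zeroJets Ω) : MemH1 Ω (F none) :=
  ⟨Lp.memLp _, fun i => ⟨_, isWeakPartial_of_mem_zeroJets hF i⟩⟩

theorem jet_of_mem_zeroJets (hΩ : IsOpen Ω) {F : Jet Ω} (hF : F ∈ zeroJets Ω) :
    jet (memH1_of_mem_zeroJets hF) = F :=
  jet_eq hΩ _ (EventuallyEq.refl _ _) (isWeakPartial_of_mem_zeroJets hF)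

theorem memH1Zero_iff (hv : MemH1 Ω v) : MemH1Zero Ω v ↔ jet hv ∈ zeroJets Ω := by
  -- the `L²` distances in the definition of `H¹₀(Ω)` are those of the entries of the jets
  have key : ∀ (f : SqInt Ω) (F : ℕ → SqInt Ω) (g : Plane → ℝ) (ψ : ℕ → Plane → ℝ),
      f =ᵐ[volume.restrict Ω] g → (∀ n, F n =ᵐ[volume.restrict Ω] ψ n) →
      (Tendsto (fun n => eLpNorm (fun x => g x - ψ n x) 2 (volume.restrict Ω)) atTop (𝓝 0) ↔
        Tendsto F atTop (𝓝 f)) := by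
    intro f F g ψ hf hF
    rw [Lp.tendsto_Lp_iff_tendsto_eLpNorm']
    refine iff_of_eq (congrArg (fun s => Tendsto s atTop (𝓝 0)) (funext fun n => ?_))
    rw [← eLpNorm_neg]
    refine eLpNorm_congr_ae ?_
    filter_upwards [hf, hF n] with x h1 h2
    simp [h1, h2]
  constructor
  · rintro ⟨-, ψ, hψ, h0, h1⟩
    choose F hF hF0 hF1 using fun n => (hψ n).exists_jet
    refine mem_closure_of_tendsto (f := F) (b := atTop) ?_ (Eventually.of_forall hF)
    rw [tendsto_jet_iff]
    intro a
    match a with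
    | none => exact (key _ _ _ _ (jet_none hv) hF0).1 h0
    | some i => exact (key _ _ _ _ (jet_some hv i) fun n => hF1 n i).1 (h1 i)
  · intro h
    obtain ⟨F, hF, hlim⟩ := mem_closure_iff_seq_limit.1 h
    choose ψ hψ h0 h1 using hF
    rw [tendsto_jet_iff] at hlim
    exact ⟨hv, ψ, hψ, (key _ _ _ _ (jet_none hv) h0).2 (hlim none),
      fun i => (key _ _ _ _ (jet_some hv i) fun n => h1 n i).2 (hlim (some i))⟩

end

/-! ### Variational problems on a closed subspace -/

section Variational

variable {H : Type*} [NormedAddCommGroup H] [InnerProductSpace ℝ H]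

/-- Solutions of coercive variational problems with the same data depend continuously on the
bilinear form. -/
theorem tendsto_variational_solution {V : Submodule ℝ H} {B : ℕ → H →L[ℝ] H →L[ℝ] ℝ}
    {A : H →L[ℝ] H →L[ℝ] ℝ} {c : ℝ} (hc : 0 < c) (hB : ∀ n, ∀ w ∈ V, c * ‖w‖ ^ 2 ≤ B n w w)
    (hBA : Tendsto B atTop (𝓝 A)) {f : H} {u : ℕ → H} {u₀ : H} (hu : ∀ n, u n - f ∈ V)
    (hu₀ : u₀ - f ∈ V) (hsol : ∀ n, ∀ v ∈ V, B n (u n) v = 0) (hsol₀ : ∀ v ∈ V, A u₀ v = 0) :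
    Tendsto u atTop (𝓝 u₀) := by
  have hle : ∀ n, ‖u n - u₀‖ ≤ c⁻¹ * (‖B n - A‖ * ‖u₀‖) := by
    intro n
    have hw : u n - u₀ ∈ V := by simpa using V.sub_mem (hu n) hu₀
    set w := u n - u₀ with hwdef
    have h1 : B n w w = -((B n - A) u₀ w) := by
      simp only [sub_apply, hsol₀ w hw]
      have : B n w = B n (u n) - B n u₀ := by rw [hwdef, map_sub]
      rw [this, sub_apply, hsol n w hw]
      ring
    have h2 : -((B n - A) u₀ w) ≤ ‖B n - A‖ * ‖u₀‖ * ‖w‖ :=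
      (neg_le_abs _).trans ((B n - A).le_opNorm₂ u₀ w)
    have h3 := hB n w hw
    rw [h1] at h3
    rw [le_inv_mul_iff₀ hc]
    rcases (norm_nonneg w).eq_or_lt with h | h
    · rw [← h]; simp; positivity
    · exact le_of_mul_le_mul_right (by nlinarith) h
  have hBA' := (tendsto_iff_norm_sub_tendsto_zero (E := H →L[ℝ] H →L[ℝ] ℝ)).1 hBA
  refine tendsto_iff_norm_sub_tendsto_zero.2 (squeeze_zero (fun _ => norm_nonneg _) hle ?_)
  simpa using (hBA'.mul_const ‖u₀‖).const_mul c⁻¹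

theorem variational_solution_unique {V : Submodule ℝ H} {B : H →L[ℝ] H →L[ℝ] ℝ} {c : ℝ}
    (hc : 0 < c) (hB : ∀ w ∈ V, c * ‖w‖ ^ 2 ≤ B w w) {f u v : H} (hu : u - f ∈ V)
    (hv : v - f ∈ V) (hsu : ∀ w ∈ V, B u w = 0) (hsv : ∀ w ∈ V, B v w = 0) : v = u :=
  tendsto_nhds_unique tendsto_const_nhds (tendsto_variational_solution hc (fun _ : ℕ => hB)
    tendsto_const_nhds (fun _ => hv) hu (fun _ => hsv) hsu)

/-- The **Lax–Milgram theorem** for inhomogeneous boundary data `f`, where `V` plays the role of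
`H¹₀`. -/
theorem exists_variational_solution [CompleteSpace H] {V : Submodule ℝ H} (hV : IsClosed (V : Set H))
    {B : H →L[ℝ] H →L[ℝ] ℝ} {c : ℝ} (hc : 0 < c) (hB : ∀ w ∈ V, c * ‖w‖ ^ 2 ≤ B w w) (f : H) :
    ∃ w ∈ V, ∀ v ∈ V, B (f + w) v = 0 := by
  have : CompleteSpace V := hV.completeSpace_coe
  have hco : IsCoercive (B.bilinearComp V.subtypeL V.subtypeL) := by
    refine ⟨c, hc, fun u => ?_⟩
    have := hB u u.2
    simpa [pow_two, mul_assoc] using this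
  let L : V →L[ℝ] ℝ := -(B f).comp V.subtypeL
  let r : V := (InnerProductSpace.toDual ℝ V).symm L
  refine ⟨hco.continuousLinearEquivOfBilin.symm r, Subtype.coe_prop _, fun v hv => ?_⟩
  have h := hco.continuousLinearEquivOfBilin_apply (hco.continuousLinearEquivOfBilin.symm r) ⟨v, hv⟩
  rw [ContinuousLinearEquiv.apply_symm_apply, InnerProductSpace.toDual_symm_apply] at h
  simp only [L, ContinuousLinearMap.bilinearComp_apply, Submodule.subtypeL_apply] at h
  rw [map_add, add_apply, ← h]
  simp

end Variational

/-! ### The elastic energy form -/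

/-- Jets of displacement fields, one jet for each component. -/
abbrev VecJet (Ω : Set Plane) : Type := PiLp 2 fun _ : Fin 2 => Jet Ω

section

variable {Ω : Set Plane} {u v w f : Plane → Plane}

/-- The jet of a displacement field in `H¹(Ω)²`. -/
def vecJet (hv : MemH1Vec Ω v) : VecJet Ω := WithLp.toLp 2 fun i => jet (hv i)

theorem MemH1Vec.sub (hv : MemH1Vec Ω v) (hw : MemH1Vec Ω w) : MemH1Vec Ω fun x => v x - w x :=
  fun i => (hv i).sub (hw i)

theorem MemH1Vec.add (hv : MemH1Vec Ω v) (hw : MemH1Vec Ω w) : MemH1Vec Ω fun x => v x + w x :=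
  fun i => (hv i).add (hw i)

theorem vecJet_sub (hΩ : IsOpen Ω) (hv : MemH1Vec Ω v) (hw : MemH1Vec Ω w) :
    vecJet (hv.sub hw) = vecJet hv - vecJet hw :=
  PiLp.ext fun i => jet_sub hΩ (hv i) (hw i)

variable (Ω) in
/-- The jets of the elements of `H¹₀(Ω)²`. -/
def zeroVecJets : Submodule ℝ (VecJet Ω) :=
  ⨅ i, (zeroJets Ω).comap (PiLp.proj 2 (fun _ : Fin 2 => Jet Ω) i : VecJet Ω →L[ℝ] Jet Ω).toLinearMap

theorem mem_zeroVecJets {F : VecJet Ω} : F ∈ zeroVecJets Ω ↔ ∀ i, F i ∈ zeroJets Ω := by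
  simp only [zeroVecJets, Submodule.mem_iInf, Submodule.mem_comap]
  rfl

theorem isClosed_zeroVecJets : IsClosed (zeroVecJets Ω : Set (VecJet Ω)) := by
  have : (zeroVecJets Ω : Set (VecJet Ω)) = ⋂ i, {F | F i ∈ zeroJets Ω} := by
    ext F; simp [mem_zeroVecJets]
  rw [this]
  exact isClosed_iInter fun i => isClosed_zeroJets.preimage (PiLp.continuous_apply 2 _ i)

theorem memH1ZeroVec_iff (hv : MemH1Vec Ω v) : MemH1ZeroVec Ω v ↔ vecJet hv ∈ zeroVecJets Ω := by
  rw [mem_zeroVecJets]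
  exact forall_congr' fun i => memH1Zero_iff (hv i)

theorem MemH1ZeroVec.memH1Vec (hv : MemH1ZeroVec Ω v) : MemH1Vec Ω v := fun i => (hv i).1

theorem exists_vecJet_eq (hΩ : IsOpen Ω) {F : VecJet Ω} (hF : F ∈ zeroVecJets Ω) :
    ∃ (w : Plane → Plane) (hw : MemH1Vec Ω w), vecJet hw = F :=
  ⟨fun x => WithLp.toLp 2 fun i => F i none x,
    fun i => memH1_of_mem_zeroJets (mem_zeroVecJets.1 hF i),
    PiLp.ext fun i => jet_of_mem_zeroJets hΩ (mem_zeroVecJets.1 hF i)⟩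

/-- The entry of a jet belonging to the `i`-th component of the field. -/
def entry (i : Fin 2) (a : Option (Fin 2)) : VecJet Ω →L[ℝ] SqInt Ω :=
  (PiLp.proj 2 (fun _ : Option (Fin 2) => SqInt Ω) a).comp (PiLp.proj 2 (fun _ : Fin 2 => Jet Ω) i)

/-- The entry `εᵢⱼ` of the strain tensor. -/
def strainEntry (i j : Fin 2) : VecJet Ω →L[ℝ] SqInt Ω :=
  (2⁻¹ : ℝ) • (entry i (some j) + entry j (some i))

/-- The divergence of a displacement field. -/
def divEntry : VecJet Ω →L[ℝ] SqInt Ω := ∑ i : Fin 2, entry i (some i)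

theorem strainEntry_vecJet (hv : MemH1Vec Ω v) (i j : Fin 2) :
    strainEntry i j (vecJet hv) =ᵐ[volume.restrict Ω] fun x => strain Ω v x i j := by
  have e : strainEntry i j (vecJet hv)
    = (2⁻¹ : ℝ) • (jet (hv i) (some j) + jet (hv j) (some i)) := rfl
  rw [e]
  filter_upwards [Lp.coeFn_smul (2⁻¹ : ℝ) (jet (hv i) (some j) + jet (hv j) (some i)),
    Lp.coeFn_add (jet (hv i) (some j)) (jet (hv j) (some i)), jet_some (hv i) j,
    jet_some (hv j) i] with x h1 h2 h3 h4
  rw [h1, Pi.smul_apply, h2, Pi.add_apply, h3, h4]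
  simp only [strain, Matrix.of_apply, smul_eq_mul]
  ring

theorem divEntry_vecJet (hv : MemH1Vec Ω v) :
    divEntry (vecJet hv) =ᵐ[volume.restrict Ω] weakDiv Ω v := by
  have e : divEntry (vecJet hv) = jet (hv 0) (some 0) + jet (hv 1) (some 1) := by
    simp [divEntry, Fin.sum_univ_two]; rfl
  rw [e]
  filter_upwards [Lp.coeFn_add (jet (hv 0) (some 0)) (jet (hv 1) (some 1)), jet_some (hv 0) 0,
    jet_some (hv 1) 1] with x h1 h2 h3
  rw [h1, Pi.add_apply, h2, h3, weakDiv, Fin.sum_univ_two]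

/-- Bounded coefficients, elements of `L^∞(Ω)`. -/
abbrev Coeff (Ω : Set Plane) : Type := Lp ℝ ⊤ (volume.restrict Ω)

/-- The form `(f, g) ↦ ∫_Ω a f g` on `L²(Ω)` with a coefficient `a ∈ L^∞(Ω)`. -/
def weightedForm : Coeff Ω →L[ℝ] SqInt Ω →L[ℝ] SqInt Ω →L[ℝ] ℝ :=
  ((ContinuousLinearMap.mul ℝ ℝ).lpPairing (volume.restrict Ω) 2 2).postcomp (SqInt Ω) ∘L
    (ContinuousLinearMap.mul ℝ ℝ).holderL (volume.restrict Ω) ⊤ 2 2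

theorem weightedForm_apply (a : Coeff Ω) (f g : SqInt Ω) :
    weightedForm a f g = ∫ x in Ω, a x * f x * g x := by
  have : weightedForm a f g = (ContinuousLinearMap.mul ℝ ℝ).lpPairing (volume.restrict Ω) 2 2
    ((ContinuousLinearMap.mul ℝ ℝ).holder 2 a f) g := rfl
  rw [this, ContinuousLinearMap.lpPairing_eq_integral]
  refine integral_congr_ae ?_
  filter_upwards [(ContinuousLinearMap.mul ℝ ℝ).coeFn_holder (r := 2) a f] with x hx
  simp [hx]

theorem integrable_coeff_mul {μ : Measure Plane} {a f g : Plane → ℝ} (ha : MemLp a ⊤ μ)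
    (hf : MemLp f 2 μ) (hg : MemLp g 2 μ) : Integrable (fun x => a x * f x * g x) μ := by
  have : MemLp (fun x => a x * f x) 2 μ := hf.mul ha
  exact this.integrable_mul hg

/-- A coefficient bounded below by `c` gives a form bounded below by `c`. -/
theorem le_weightedForm {a : Coeff Ω} {c : ℝ} (ha : ∀ᵐ x ∂volume.restrict Ω, c ≤ a x)
    (f : SqInt Ω) : c * ‖f‖ ^ 2 ≤ weightedForm a f f := by
  rw [← real_inner_self_eq_norm_sq, SqInt.inner_eq, weightedForm_apply, ← integral_const_mul]
  refine integral_mono_ae ?_ (integrable_coeff_mul (Lp.memLp a) (Lp.memLp f) (Lp.memLp f)) ?_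
  · exact (integrable_mul_of_memLp_two (Lp.memLp f) (Lp.memLp f)).const_mul c
  · filter_upwards [ha] with x hx
    have := mul_self_nonneg (f x)
    calc c * (f x * f x) ≤ a x * (f x * f x) := by gcongr
      _ = a x * f x * f x := by ring

/-- The bilinear form `∫_Ω 2 μ ε(u) : ε(w) + λ (∇ · u) (∇ · w)` of linear elasticity. -/
def elasticForm (μ l : Coeff Ω) : VecJet Ω →L[ℝ] VecJet Ω →L[ℝ] ℝ :=
  (2 : ℝ) • ∑ i : Fin 2, ∑ j : Fin 2,
      (weightedForm μ).bilinearComp (strainEntry i j) (strainEntry i j)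
    + (weightedForm l).bilinearComp divEntry divEntry

set_option synthInstance.maxHeartbeats 200000 in
theorem continuous_elasticForm :
    Continuous fun p : Coeff Ω × Coeff Ω => elasticForm p.1 p.2 := by
  have key : ∀ (S T : VecJet Ω →L[ℝ] SqInt Ω),
      Continuous fun a : Coeff Ω => (weightedForm a).bilinearComp S T := by
    intro S T
    have h1 : Continuous fun a : Coeff Ω => ((weightedForm a).comp S).flip :=
      (ContinuousLinearMap.flipₗᵢ ℝ _ _ _).continuous.comp
        (weightedForm.continuous.clm_comp continuous_const)
    exact (ContinuousLinearMap.flipₗᵢ ℝ _ _ _).continuous.comp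
      (h1.clm_comp continuous_const)
  unfold elasticForm
  have hsum : Continuous fun p : Coeff Ω × Coeff Ω => ∑ i : Fin 2, ∑ j : Fin 2,
      (weightedForm p.1).bilinearComp (strainEntry i j) (strainEntry i j) := by
    refine continuous_finsetSum Finset.univ fun i _ => ?_
    refine continuous_finsetSum Finset.univ fun j _ => ?_
    exact (key _ _).comp continuous_fst
  exact (hsum.const_smul (2 : ℝ)).add ((key _ _).comp continuous_snd)

theorem tendsto_comp_of_continuous₂ {X Y Z : Type*} [TopologicalSpace X] [TopologicalSpace Y]
    [TopologicalSpace Z] {g : X → Y → Z} (hg : Continuous fun p : X × Y => g p.1 p.2)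
    {x : ℕ → X} {y : ℕ → Y} {x₀ : X} {y₀ : Y} (hx : Tendsto x atTop (𝓝 x₀))
    (hy : Tendsto y atTop (𝓝 y₀)) : Tendsto (fun n => g (x n) (y n)) atTop (𝓝 (g x₀ y₀)) :=
  (hg.tendsto (x₀, y₀)).comp (hx.prodMk_nhds hy)

theorem tendsto_elasticForm {μ l : ℕ → Coeff Ω} {μ₀ l₀ : Coeff Ω} (hμ : Tendsto μ atTop (𝓝 μ₀))
    (hl : Tendsto l atTop (𝓝 l₀)) :
    Tendsto (fun n => elasticForm (μ n) (l n)) atTop (𝓝 (elasticForm μ₀ l₀)) :=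
  tendsto_comp_of_continuous₂ continuous_elasticForm hμ hl

theorem elasticForm_apply (μ l : Coeff Ω) (F G : VecJet Ω) :
    elasticForm μ l F G = 2 * ∑ i : Fin 2, ∑ j : Fin 2,
        weightedForm μ (strainEntry i j F) (strainEntry i j G)
      + weightedForm l (divEntry F) (divEntry G) := by
  simp [elasticForm, Fin.sum_univ_two]
  ring

/-- The weak form of the equations of elasticity, expressed by jets. -/
theorem elasticForm_vecJet {ℓ : LamePair} (h1 : MemLp ℓ.1 ⊤ (volume.restrict Ω))
    (h2 : MemLp ℓ.2 ⊤ (volume.restrict Ω)) (hu : MemH1Vec Ω u) (hw : MemH1Vec Ω w) :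
    elasticForm (h1.toLp _) (h2.toLp _) (vecJet hu) (vecJet hw)
      = ∫ x in Ω, (2 * ℓ.1 x * (∑ i, ∑ j, strain Ω u x i j * strain Ω w x i j)
        + ℓ.2 x * (weakDiv Ω u x * weakDiv Ω w x)) := by
  have hI : ∀ (a : Coeff Ω) (f g : SqInt Ω),
      Integrable (fun x => a x * f x * g x) (volume.restrict Ω) :=
    fun a f g => integrable_coeff_mul (Lp.memLp a) (Lp.memLp f) (Lp.memLp g)
  rw [elasticForm_apply]
  simp only [weightedForm_apply]
  simp_rw [← integral_finsetSum _ fun j _ => hI _ _ _]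
  rw [← integral_finsetSum _ fun i _ => integrable_finsetSum _ fun j _ => hI _ _ _,
    ← integral_const_mul, ← integral_add
      ((integrable_finsetSum _ fun i _ => integrable_finsetSum _ fun j _ => hI _ _ _).const_mul 2)
      (hI _ _ _)]
  refine integral_congr_ae ?_
  filter_upwards [h1.coeFn_toLp, h2.coeFn_toLp, divEntry_vecJet hu, divEntry_vecJet hw,
    ae_all_iff.2 fun i => ae_all_iff.2 fun j => strainEntry_vecJet hu i j,
    ae_all_iff.2 fun i => ae_all_iff.2 fun j => strainEntry_vecJet hw i j] with x e1 e2 e3 e4 e5 e6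
  simp only [e1, e2, e3, e4, e5, e6, Finset.mul_sum]
  ring_nf

/-- Coercivity of the elastic form on `H¹₀(Ω)²`, by Korn's first inequality and Poincaré's
inequality. -/
theorem elasticForm_coercive (hΩ : IsOpen Ω) {R c : ℝ} (hR0 : 0 ≤ R) (hR : ∀ x ∈ Ω, |x 0| ≤ R)
    (hc : 0 < c) {μ l : Coeff Ω} (hμ : ∀ᵐ x ∂volume.restrict Ω, c ≤ μ x)
    (hl : ∀ᵐ x ∂volume.restrict Ω, c ≤ l x) {F : VecJet Ω} (hF : F ∈ zeroVecJets Ω) :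
    c / (1 + (2 * R) ^ 2) * ‖F‖ ^ 2 ≤ elasticForm μ l F F := by
  rw [mem_zeroVecJets] at hF
  have hP : ∀ i, ‖F i none‖ ^ 2 ≤ (2 * R) ^ 2 * ‖F i (some 0)‖ ^ 2 := by
    intro i
    have := norm_zeroJets_le hR hR0 hΩ (hF i)
    calc ‖F i none‖ ^ 2 ≤ (2 * R * ‖F i (some 0)‖) ^ 2 := by gcongr
      _ = _ := by ring
  have hN : ‖F‖ ^ 2 = ∑ i, (‖F i none‖ ^ 2 + (‖F i (some 0)‖ ^ 2 + ‖F i (some 1)‖ ^ 2)) := by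
    rw [PiLp.norm_sq_eq_of_L2]
    refine Finset.sum_congr rfl fun i _ => ?_
    rw [PiLp.norm_sq_eq_of_L2, Fintype.sum_option, Fin.sum_univ_two]
  have hK : inner ℝ (F 0 (some 0)) (F 1 (some 1)) = inner ℝ (F 0 (some 1)) (F 1 (some 0)) :=
    inner_zeroJets_comm (hF 0) (hF 1) 0 1
  have hs : ∀ i j, ‖strainEntry i j F‖ ^ 2 = 4⁻¹ * (‖F i (some j)‖ ^ 2
      + 2 * inner ℝ (F i (some j)) (F j (some i)) + ‖F j (some i)‖ ^ 2) := by
    intro i j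
    have : strainEntry i j F = (2⁻¹ : ℝ) • (F i (some j) + F j (some i)) := rfl
    rw [this, norm_smul, mul_pow, norm_add_sq_real]
    norm_num
  have hdiag : ∀ i, inner ℝ (F i (some i)) (F i (some i)) = ‖F i (some i)‖ ^ 2 :=
    fun i => real_inner_self_eq_norm_sq _
  have hKorn : ‖F 0 (some 0)‖ ^ 2 + ‖F 0 (some 1)‖ ^ 2 + ‖F 1 (some 0)‖ ^ 2
      + ‖F 1 (some 1)‖ ^ 2 ≤ 2 * ∑ i, ∑ j, ‖strainEntry i j F‖ ^ 2 := by
    simp only [Fin.sum_univ_two, hs, hdiag]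
    have h1 := norm_add_sq_real (F 0 (some 0)) (F 1 (some 1))
    have h2 := sq_nonneg ‖F 0 (some 0) + F 1 (some 1)‖
    have h3 := real_inner_comm (F 0 (some 1)) (F 1 (some 0))
    rw [h3]
    linarith
  have hE : c * (2 * ∑ i, ∑ j, ‖strainEntry i j F‖ ^ 2) ≤ elasticForm μ l F F := by
    rw [elasticForm_apply]
    have hd : 0 ≤ weightedForm l (divEntry F) (divEntry F) :=
      le_trans (by positivity) (le_weightedForm hl (divEntry F))
    have : c * ∑ i, ∑ j, ‖strainEntry i j F‖ ^ 2
        ≤ ∑ i, ∑ j, weightedForm μ (strainEntry i j F) (strainEntry i j F) := by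
      simp only [Finset.mul_sum]
      exact Finset.sum_le_sum fun i _ => Finset.sum_le_sum fun j _ => le_weightedForm hμ _
    linarith
  refine le_trans ?_ hE
  rw [div_mul_eq_mul_div, mul_div_assoc]
  refine mul_le_mul_of_nonneg_left (le_trans ?_ hKorn) hc.le
  rw [div_le_iff₀ (by positivity), hN]
  simp only [Fin.sum_univ_two]
  have := hP 0
  have := hP 1
  nlinarith [mul_nonneg (sq_nonneg (2 * R)) (sq_nonneg ‖F 0 (some 1)‖),
    mul_nonneg (sq_nonneg (2 * R)) (sq_nonneg ‖F 1 (some 0)‖),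
    mul_nonneg (sq_nonneg (2 * R)) (sq_nonneg ‖F 1 (some 1)‖)]

end

/-! ### The forward problem -/

section

variable {Ω : Set Plane} {u v w f z : Plane → Plane} {ℓ : LamePair} {C₁ C₂ : ℝ}

theorem isWeakSolution_iff (hΩ : IsOpen Ω) (hℓ : ℓ ∈ admissible Ω C₁ C₂) (hf : MemH1Vec Ω f)
    (hu : MemH1Vec Ω u) :
    IsWeakSolution Ω ℓ f u ↔ vecJet hu - vecJet hf ∈ zeroVecJets Ω ∧
      ∀ W ∈ zeroVecJets Ω, elasticForm (hℓ.1.toLp _) (hℓ.2.1.toLp _) (vecJet hu) W = 0 := by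
  rw [IsWeakSolution, memH1ZeroVec_iff (hu.sub hf), vecJet_sub hΩ hu hf]
  refine ⟨fun h => ⟨h.2.1, fun W hW => ?_⟩, fun h => ⟨hu, h.1, fun w hw => ?_⟩⟩
  · obtain ⟨w, hw, rfl⟩ := exists_vecJet_eq hΩ hW
    rw [elasticForm_vecJet]
    exact h.2.2 w ((memH1ZeroVec_iff hw).2 hW)
  · rw [← elasticForm_vecJet hℓ.1 hℓ.2.1 hu hw.memH1Vec]
    exact h.2 _ ((memH1ZeroVec_iff _).1 hw)

/-- The coefficients of an admissible pair are bounded below by `C₁`. -/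
theorem le_toLp {a : Plane → ℝ} (ha : MemLp a ⊤ (volume.restrict Ω))
    (h : ∀ᵐ x ∂volume.restrict Ω, a x ∈ Icc C₁ C₂) :
    ∀ᵐ x ∂volume.restrict Ω, C₁ ≤ ha.toLp a x := by
  filter_upwards [ha.coeFn_toLp, h] with x h1 h2
  rw [h1]
  exact h2.1

theorem exists_coercive (hΩ : IsOpen Ω) (hb : Bornology.IsBounded Ω) (hC₁ : 0 < C₁) :
    ∃ c : ℝ, 0 < c ∧ ∀ ℓ, ∀ hℓ : ℓ ∈ admissible Ω C₁ C₂, ∀ F ∈ zeroVecJets Ω,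
      c * ‖F‖ ^ 2 ≤ elasticForm (hℓ.1.toLp _) (hℓ.2.1.toLp _) F F := by
  obtain ⟨R, hR⟩ := hb.exists_norm_le
  refine ⟨C₁ / (1 + (2 * max R 0) ^ 2), by positivity, fun ℓ hℓ F hF => ?_⟩
  refine elasticForm_coercive hΩ (le_max_right R 0) (fun x hx => ?_) hC₁
    (le_toLp hℓ.1 hℓ.2.2.1) (le_toLp hℓ.2.1 hℓ.2.2.2.1) hF
  exact (PiLp.norm_apply_le x 0).trans ((hR x hx).trans (le_max_left _ _))

theorem exists_isWeakSolution (hΩ : IsOpen Ω) (hb : Bornology.IsBounded Ω) (hC₁ : 0 < C₁)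
    (hf : MemH1Vec Ω f) (hℓ : ℓ ∈ admissible Ω C₁ C₂) : ∃ u, IsWeakSolution Ω ℓ f u := by
  obtain ⟨c, hc, hco⟩ := exists_coercive (C₂ := C₂) hΩ hb hC₁
  obtain ⟨W, hW, h⟩ := exists_variational_solution isClosed_zeroVecJets hc (hco ℓ hℓ) (vecJet hf)
  obtain ⟨w, hw, rfl⟩ := exists_vecJet_eq hΩ hW
  have hsub : vecJet (hf.add hw) - vecJet hf = vecJet hw := by
    rw [← vecJet_sub hΩ]
    congr 1
    simp
  refine ⟨fun x => f x + w x, (isWeakSolution_iff hΩ hℓ hf (hf.add hw)).2 ⟨?_, ?_⟩⟩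
  · rwa [hsub]
  · rwa [eq_add_of_sub_eq' hsub]

theorem displacement_spec (hΩ : IsOpen Ω) (hb : Bornology.IsBounded Ω) (hC₁ : 0 < C₁)
    (hf : MemH1Vec Ω f) (hℓ : ℓ ∈ admissible Ω C₁ C₂) :
    IsWeakSolution Ω ℓ f (displacement Ω f ℓ) :=
  Classical.epsilon_spec (exists_isWeakSolution hΩ hb hC₁ hf hℓ)

theorem IsWeakSolution.ae_eq (hΩ : IsOpen Ω) (hb : Bornology.IsBounded Ω) (hC₁ : 0 < C₁)
    (hf : MemH1Vec Ω f) (hℓ : ℓ ∈ admissible Ω C₁ C₂) (hu : IsWeakSolution Ω ℓ f u)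
    (hv : IsWeakSolution Ω ℓ f v) : v =ᵐ[volume.restrict Ω] u := by
  obtain ⟨c, hc, hco⟩ := exists_coercive (C₂ := C₂) hΩ hb hC₁
  have hu' := (isWeakSolution_iff hΩ hℓ hf hu.1).1 hu
  have hv' := (isWeakSolution_iff hΩ hℓ hf hv.1).1 hv
  have heq : vecJet hv.1 = vecJet hu.1 :=
    variational_solution_unique hc (hco ℓ hℓ) hu'.1 hv'.1 hu'.2 hv'.2
  have hi : ∀ i, ∀ᵐ x ∂volume.restrict Ω, v x i = u x i := by
    intro i
    have e : jet (hv.1 i) = jet (hu.1 i) := congrArg (fun F : VecJet Ω => F i) heq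
    have h1 := jet_none (hv.1 i)
    rw [e] at h1
    exact h1.symm.trans (jet_none (hu.1 i))
  filter_upwards [ae_all_iff.2 hi] with x hx
  exact PiLp.ext hx

theorem tendsto_toLp_top {a : ℕ → Plane → ℝ} {b : Plane → ℝ} {δ : ℕ → ℝ}
    (ha : ∀ n, MemLp (a n) ⊤ (volume.restrict Ω)) (hb : MemLp b ⊤ (volume.restrict Ω))
    (hδ : Tendsto δ atTop (𝓝 0)) (h : ∀ n, ∀ᵐ x ∂volume.restrict Ω, |a n x - b x| ≤ δ n) :
    Tendsto (fun n => (ha n).toLp (a n)) atTop (𝓝 (hb.toLp b)) := by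
  rw [Lp.tendsto_Lp_iff_tendsto_eLpNorm'']
  have hδ' : Tendsto (fun n => ENNReal.ofReal (δ n)) atTop (𝓝 0) := by
    simpa using ENNReal.tendsto_ofReal hδ
  refine tendsto_of_tendsto_of_tendsto_of_le_of_le tendsto_const_nhds hδ' (fun _ => zero_le)
    fun n => ?_
  rw [eLpNorm_exponent_top]
  exact eLpNormEssSup_le_of_ae_bound (h n)

/-- The displacement depends continuously on the coefficients, for uniform convergence of the
coefficients and convergence in `H¹(Ω)²` of the displacements. -/
theorem tendsto_vecJet_displacement (hΩ : IsOpen Ω) (hb : Bornology.IsBounded Ω) (hC₁ : 0 < C₁)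
    (hf : MemH1Vec Ω f) {L : ℕ → LamePair} (hL : ∀ n, L n ∈ admissible Ω C₁ C₂)
    (hℓ : ℓ ∈ admissible Ω C₁ C₂) {δ : ℕ → ℝ} (hδ : Tendsto δ atTop (𝓝 0))
    (h1 : ∀ n, ∀ᵐ x ∂volume.restrict Ω, |(L n).1 x - ℓ.1 x| ≤ δ n)
    (h2 : ∀ n, ∀ᵐ x ∂volume.restrict Ω, |(L n).2 x - ℓ.2 x| ≤ δ n) :
    Tendsto (fun n => vecJet (displacement_spec hΩ hb hC₁ hf (hL n)).1) atTop
      (𝓝 (vecJet (displacement_spec hΩ hb hC₁ hf hℓ).1)) := by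
  obtain ⟨c, hc, hco⟩ := exists_coercive (C₂ := C₂) hΩ hb hC₁
  have hn := fun n => (isWeakSolution_iff hΩ (hL n) hf
    (displacement_spec hΩ hb hC₁ hf (hL n)).1).1 (displacement_spec hΩ hb hC₁ hf (hL n))
  have h0 := (isWeakSolution_iff hΩ hℓ hf (displacement_spec hΩ hb hC₁ hf hℓ).1).1
    (displacement_spec hΩ hb hC₁ hf hℓ)
  have hA := tendsto_elasticForm (tendsto_toLp_top (fun n => (hL n).1) hℓ.1 hδ h1)
    (tendsto_toLp_top (fun n => (hL n).2.1) hℓ.2.1 hδ h2)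
  exact tendsto_variational_solution hc (fun n => hco (L n) (hL n)) hA (fun n => (hn n).1) h0.1
    (fun n => (hn n).2) h0.2

/-- Finitely many sequences converging in `L²(Ω)` converge almost everywhere along a common
subsequence. -/
theorem exists_subseq_tendsto_ae {ι : Type*} [Finite ι] {F : ι → ℕ → SqInt Ω} {G : ι → SqInt Ω}
    (h : ∀ i, Tendsto (F i) atTop (𝓝 (G i))) :
    ∃ φ : ℕ → ℕ, StrictMono φ ∧ ∀ i, ∀ᵐ x ∂volume.restrict Ω,
      Tendsto (fun n => F i (φ n) x) atTop (𝓝 (G i x)) := by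
  classical
  have := Fintype.ofFinite ι
  suffices H : ∀ s : Finset ι, ∃ φ : ℕ → ℕ, StrictMono φ ∧ ∀ i ∈ s, ∀ᵐ x ∂volume.restrict Ω,
      Tendsto (fun n => F i (φ n) x) atTop (𝓝 (G i x)) by
    obtain ⟨φ, hφ, h'⟩ := H Finset.univ
    exact ⟨φ, hφ, fun i => h' i (Finset.mem_univ i)⟩
  intro s
  induction s using Finset.induction_on with
  | empty => exact ⟨id, strictMono_id, by simp⟩
  | insert i s _ ih =>
    obtain ⟨φ, hφ, hs⟩ := ih
    obtain ⟨ψ, hψ, hi⟩ := (tendstoInMeasure_of_tendsto_Lp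
      ((h i).comp hφ.tendsto_atTop)).exists_seq_tendsto_ae
    refine ⟨φ ∘ ψ, hφ.comp hψ, fun j hj => ?_⟩
    rcases Finset.mem_insert.1 hj with rfl | hj
    · exact hi
    · filter_upwards [hs j hj] with x hx
      exact hx.comp hψ.tendsto_atTop

/-! ### The energy density -/

theorem memLp_strain (hv : MemH1Vec Ω v) (i j : Fin 2) :
    MemLp (fun x => strain Ω v x i j) 2 (volume.restrict Ω) :=
  (memLp_congr_ae (strainEntry_vecJet hv i j)).1 (Lp.memLp _)

theorem memLp_weakDiv (hv : MemH1Vec Ω v) : MemLp (weakDiv Ω v) 2 (volume.restrict Ω) :=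
  (memLp_congr_ae (divEntry_vecJet hv)).1 (Lp.memLp _)

theorem integrable_energyDensity (hℓ : ℓ ∈ admissible Ω C₁ C₂) (hv : MemH1Vec Ω v) :
    Integrable (energyDensity Ω ℓ v) (volume.restrict Ω) := by
  have h1 : ∀ i j, Integrable (fun x => ℓ.1 x * strain Ω v x i j * strain Ω v x i j)
      (volume.restrict Ω) :=
    fun i j => integrable_coeff_mul hℓ.1 (memLp_strain hv i j) (memLp_strain hv i j)
  have h2 := integrable_coeff_mul hℓ.2.1 (memLp_weakDiv hv) (memLp_weakDiv hv)
  refine (((integrable_finsetSum Finset.univ fun i _ => integrable_finsetSum Finset.univ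
    fun j _ => h1 i j).const_mul 2).add h2).congr ?_
  filter_upwards with x
  simp only [energyDensity, Pi.add_apply, Fin.sum_univ_two]
  ring

/-- Uniform convergence of the coefficients implies, along a subsequence, convergence almost
everywhere of the energy densities of the misfit. -/
theorem exists_subseq_energyDensity (hΩ : IsOpen Ω) (hb : Bornology.IsBounded Ω) (hC₁ : 0 < C₁)
    (hf : MemH1Vec Ω f) (hz : MemH1Vec Ω z) {L : ℕ → LamePair}
    (hL : ∀ n, L n ∈ admissible Ω C₁ C₂)
    (hℓ : ℓ ∈ admissible Ω C₁ C₂) {δ : ℕ → ℝ} (hδ : Tendsto δ atTop (𝓝 0))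
    (h1 : ∀ n, ∀ᵐ x ∂volume.restrict Ω, |(L n).1 x - ℓ.1 x| ≤ δ n)
    (h2 : ∀ n, ∀ᵐ x ∂volume.restrict Ω, |(L n).2 x - ℓ.2 x| ≤ δ n) :
    ∃ φ : ℕ → ℕ, StrictMono φ ∧ ∀ᵐ x ∂volume.restrict Ω, Tendsto
      (fun n => energyDensity Ω (L (φ n)) (fun x => displacement Ω f (L (φ n)) x - z x) x) atTop
      (𝓝 (energyDensity Ω ℓ (fun x => displacement Ω f ℓ x - z x) x)) := by
  set hun := fun n => (displacement_spec hΩ hb hC₁ hf (hL n)).1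
  set hu := (displacement_spec hΩ hb hC₁ hf hℓ).1
  have hlim : Tendsto (fun n => vecJet ((hun n).sub hz)) atTop (𝓝 (vecJet (hu.sub hz))) := by
    have hsub := fun n => vecJet_sub hΩ (hun n) hz
    simp only [hsub, vecJet_sub hΩ hu hz]
    exact (tendsto_vecJet_displacement hΩ hb hC₁ hf hL hℓ hδ h1 h2).sub_const _
  let T : Option (Fin 2 × Fin 2) → VecJet Ω →L[ℝ] SqInt Ω
    | none => divEntry
    | some p => strainEntry p.1 p.2
  obtain ⟨φ, hφ, hae⟩ := exists_subseq_tendsto_ae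
    (F := fun t n => T t (vecJet ((hun n).sub hz))) (G := fun t => T t (vecJet (hu.sub hz)))
    fun t => ((T t).continuous.tendsto _).comp hlim
  refine ⟨φ, hφ, ?_⟩
  filter_upwards [ae_all_iff.2 hae, ae_all_iff.2 h1, ae_all_iff.2 h2,
    divEntry_vecJet (hu.sub hz), ae_all_iff.2 fun n => divEntry_vecJet ((hun n).sub hz),
    ae_all_iff.2 fun i => ae_all_iff.2 fun j => strainEntry_vecJet (hu.sub hz) i j,
    ae_all_iff.2 fun n => ae_all_iff.2 fun i => ae_all_iff.2 fun j =>
      strainEntry_vecJet ((hun n).sub hz) i j] with x e1 e2 e3 e4 e5 e6 e7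
  have hdiv : Tendsto (fun n => weakDiv Ω (fun x => displacement Ω f (L (φ n)) x - z x) x) atTop
      (𝓝 (weakDiv Ω (fun x => displacement Ω f ℓ x - z x) x)) := by
    have := e1 none
    simpa only [T, e4, e5] using this
  have hstr : ∀ i j, Tendsto
      (fun n => strain Ω (fun x => displacement Ω f (L (φ n)) x - z x) x i j) atTop
      (𝓝 (strain Ω (fun x => displacement Ω f ℓ x - z x) x i j)) := by
    intro i j
    have := e1 (some (i, j))
    simpa only [T, e6, e7] using this
  have hcoef : ∀ (a : ℕ → ℝ) (b : ℝ), (∀ n, |a n - b| ≤ δ n) →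
      Tendsto (fun n => a (φ n)) atTop (𝓝 b) := by
    intro a b hab
    have : Tendsto a atTop (𝓝 b) :=
      tendsto_iff_norm_sub_tendsto_zero.2 (squeeze_zero (fun _ => norm_nonneg _) hab hδ)
    exact this.comp hφ.tendsto_atTop
  unfold energyDensity
  exact ((((hcoef _ _ e2).const_mul 2).mul (tendsto_finsetSum _ fun i _ =>
    tendsto_finsetSum _ fun j _ => (hstr i j).pow 2)).add ((hcoef _ _ e3).mul (hdiv.pow 2)))

end

/-! ### Integration in curvilinear coordinates -/

/-- Cartesian coordinates with origin `O`. -/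
def cartesian (O : Plane) : ℝ × ℝ ≃ᵐ Plane :=
  (MeasurableEquiv.finTwoArrow.symm.trans (MeasurableEquiv.toLp 2 (Fin 2 → ℝ))).trans
    (MeasurableEquiv.addLeft O)

theorem cartesian_apply (O : Plane) (p : ℝ × ℝ) : cartesian O p = O + !₂[p.1, p.2] := rfl

theorem measurePreserving_cartesian (O : Plane) : MeasurePreserving (cartesian O) :=
  (measurePreserving_add_left volume O).comp ((PiLp.volume_preserving_toLp (Fin 2)).comp
    (volume_preserving_finTwoArrow ℝ).symm)

theorem cartesian_polar (O : Plane) (s φ : ℝ) :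
    cartesian O (s * Real.cos φ, s * Real.sin φ) = O + s • direction φ := by
  rw [cartesian_apply, direction]
  congr 1
  ext i
  fin_cases i <;> simp

theorem continuous_direction : Continuous direction := by
  unfold direction
  fun_prop

theorem direction_add_two_pi (φ : ℝ) : direction (φ + 2 * Real.pi) = direction φ := by
  simp [direction]

/-- Polar coordinates over one period of the angle, as an inequality. The factor `2` is not
optimal: it accounts for the two halves of the period being treated separately. -/
theorem lintegral_polar_le (O : Plane) {g : Plane → ℝ≥0∞} (hg : Measurable g) :
    ∫⁻ φ in Ico 0 (2 * Real.pi), ∫⁻ s in Ioi (0 : ℝ), ENNReal.ofReal s * g (O + s • direction φ)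
      ≤ 2 * ∫⁻ x, g x := by
  set h : ℝ → ℝ≥0∞ := fun φ => ∫⁻ s in Ioi (0 : ℝ), ENNReal.ofReal s * g (O + s • direction φ)
    with hh
  have hper : ∀ φ, h (φ + 2 * Real.pi) = h φ := fun φ => by simp only [hh, direction_add_two_pi]
  have hmeas : Measurable fun p : ℝ × ℝ => ENNReal.ofReal p.1 * g (O + p.1 • direction p.2) := by
    have : Continuous fun p : ℝ × ℝ => O + p.1 • direction p.2 :=
      continuous_const.add (continuous_fst.smul (continuous_direction.comp continuous_snd))
    exact (ENNReal.measurable_ofReal.comp measurable_fst).mul (hg.comp this.measurable)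
  have hpi := Real.pi_pos
  have htot : ∫⁻ φ in Ico (-Real.pi) Real.pi, h φ = ∫⁻ x, g x := by
    rw [← (measurePreserving_cartesian O).lintegral_comp hg,
      ← lintegral_comp_polarCoord_symm fun p => g (cartesian O p)]
    have ht : polarCoord.target = Ioi (0 : ℝ) ×ˢ Ioo (-Real.pi) Real.pi := rfl
    have hs : ∀ p : ℝ × ℝ, ENNReal.ofReal p.1 • g (cartesian O (polarCoord.symm p))
        = ENNReal.ofReal p.1 * g (O + p.1 • direction p.2) := by
      intro p
      rw [polarCoord_symm_apply, cartesian_polar, smul_eq_mul]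
    simp only [hs]
    rw [ht, Measure.volume_eq_prod, ← Measure.prod_restrict, lintegral_prod_symm' _ hmeas,
      Measure.restrict_congr_set Ioo_ae_eq_Ico.symm]
  have hshift : ∫⁻ φ in Ico Real.pi (2 * Real.pi), h φ ≤ ∫⁻ φ in Ico (-Real.pi) Real.pi, h φ := by
    rw [← (measurePreserving_add_right volume (2 * Real.pi)).setLIntegral_comp_preimage_emb
      (measurableEmbedding_addRight _)]
    simp only [hper]
    refine lintegral_mono_set fun φ hφ => ?_
    have h1 : Real.pi ≤ φ + 2 * Real.pi := hφ.1
    have h2 : φ + 2 * Real.pi < 2 * Real.pi := hφ.2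
    exact ⟨by linarith, by linarith⟩
  have hsplit : Ico 0 (2 * Real.pi) ⊆ Ico 0 Real.pi ∪ Ico Real.pi (2 * Real.pi) :=
    Ico_subset_Ico_union_Ico
  calc ∫⁻ φ in Ico 0 (2 * Real.pi), h φ
      ≤ ∫⁻ φ in Ico 0 Real.pi ∪ Ico Real.pi (2 * Real.pi), h φ := lintegral_mono_set hsplit
    _ ≤ (∫⁻ φ in Ico 0 Real.pi, h φ) + ∫⁻ φ in Ico Real.pi (2 * Real.pi), h φ :=
        lintegral_union_le _ _ _
    _ ≤ (∫⁻ φ in Ico (-Real.pi) Real.pi, h φ) + ∫⁻ φ in Ico (-Real.pi) Real.pi, h φ := by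
        refine add_le_add (lintegral_mono_set (Ico_subset_Ico_left (by linarith))) hshift
    _ = 2 * ∫⁻ x, g x := by rw [htot, two_mul]

/-- The substitution `s = e^ρ r` along a ray. -/
theorem lintegral_ray {r : ℝ} (hr : 0 < r) (G : ℝ → ℝ≥0∞) :
    ∫⁻ ρ in Iio (0 : ℝ), G (Real.exp ρ * r) * ENNReal.ofReal (Real.exp (2 * ρ) * r ^ 2)
      = ∫⁻ s in Ioo 0 r, ENNReal.ofReal s * G s := by
  have him : (fun ρ => Real.exp ρ * r) '' Iio 0 = Ioo 0 r := by
    ext s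
    constructor
    · rintro ⟨ρ, hρ, rfl⟩
      have := Real.exp_lt_one_iff.mpr (mem_Iio.1 hρ)
      have := Real.exp_pos ρ
      exact ⟨by positivity, by nlinarith⟩
    · rintro ⟨h0, h1⟩
      refine ⟨Real.log (s / r), Real.log_neg (by positivity) ((div_lt_one hr).2 h1), ?_⟩
      simp only [Real.exp_log (div_pos h0 hr)]
      field_simp
  rw [← him, lintegral_image_eq_lintegral_abs_deriv_mul (f' := fun ρ => Real.exp ρ * r)
    measurableSet_Iio (fun ρ _ => ((Real.hasDerivAt_exp ρ).mul_const r).hasDerivWithinAt)]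
  · refine lintegral_congr fun ρ => ?_
    have := Real.exp_pos ρ
    rw [abs_of_pos (by positivity), ← mul_assoc, ← ENNReal.ofReal_mul (by positivity), mul_comm]
    congr 2
    rw [two_mul, Real.exp_add]
    ring
  · intro x _ y _ hxy
    exact Real.exp_injective (mul_right_cancel₀ hr.ne' hxy)

/-- The integral of `g` over the sector of the angles in `[a, b)`, in curvilinear coordinates. -/
def curvIntegral (O : Plane) (r : ℝ → ℝ) (a b : ℝ) (g : Plane → ℝ≥0∞) : ℝ≥0∞ :=
  ∫⁻ ρ in Iic (0 : ℝ), ∫⁻ φ in Ico a b,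
    g (curvilinear O r ρ φ) * ENNReal.ofReal (Real.exp (2 * ρ) * r φ ^ 2)

section

variable {Ω : Set Plane} {O : Plane} {r r' : ℝ → ℝ} {a b : ℝ}

theorem curvIntegral_congr_radius (h : ∀ φ ∈ Ico a b, r φ = r' φ) (g : Plane → ℝ≥0∞) :
    curvIntegral O r a b g = curvIntegral O r' a b g := by
  refine lintegral_congr fun ρ => setLIntegral_congr_fun measurableSet_Ico fun φ hφ => ?_
  simp only [curvilinear, h φ hφ]

theorem starRegion_congr (h : ∀ φ ∈ Ico 0 (2 * Real.pi), r φ = r' φ) :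
    starRegion O r = starRegion O r' := by
  ext x
  constructor
  · rintro ⟨s, φ, h1, h2, h3, h4⟩
    exact ⟨s, φ, h1, h φ h3 ▸ h2, h3, h4⟩
  · rintro ⟨s, φ, h1, h2, h3, h4⟩
    exact ⟨s, φ, h1, (h φ h3).symm ▸ h2, h3, h4⟩

theorem measurable_curvIntegrand (hr : Measurable r) {g : Plane → ℝ≥0∞} (hg : Measurable g) :
    Measurable fun p : ℝ × ℝ =>
      g (curvilinear O r p.1 p.2) * ENNReal.ofReal (Real.exp (2 * p.1) * r p.2 ^ 2) := by
  have hr2 : Measurable fun p : ℝ × ℝ => r p.2 := hr.comp measurable_snd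
  have hX : Measurable fun p : ℝ × ℝ => curvilinear O r p.1 p.2 := by
    have h1 : Measurable fun p : ℝ × ℝ => Real.exp p.1 * r p.2 :=
      (Real.measurable_exp.comp measurable_fst).mul hr2
    exact (h1.smul (continuous_direction.measurable.comp measurable_snd)).const_add O
  refine (hg.comp hX).mul (ENNReal.measurable_ofReal.comp ?_)
  exact (Real.measurable_exp.comp (measurable_fst.const_mul 2)).mul (hr2.pow_const 2)

theorem measurable_curvIntegrand_angle (hr : Measurable r) {g : Plane → ℝ≥0∞}
    (hg : Measurable g) (ρ : ℝ) : Measurable fun φ =>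
      g (curvilinear O r ρ φ) * ENNReal.ofReal (Real.exp (2 * ρ) * r φ ^ 2) :=
  (measurable_curvIntegrand hr hg).of_uncurry_left (x := ρ)
    (f := fun ρ φ => g (curvilinear O r ρ φ) * ENNReal.ofReal (Real.exp (2 * ρ) * r φ ^ 2))

theorem measurable_lintegral_curvIntegrand (hr : Measurable r) {g : Plane → ℝ≥0∞}
    (hg : Measurable g) : Measurable fun ρ => ∫⁻ φ in Ico a b,
      g (curvilinear O r ρ φ) * ENNReal.ofReal (Real.exp (2 * ρ) * r φ ^ 2) :=
  Measurable.lintegral_prod_right (measurable_curvIntegrand hr hg)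
    (f := fun ρ φ => g (curvilinear O r ρ φ) * ENNReal.ofReal (Real.exp (2 * ρ) * r φ ^ 2))

theorem curvIntegral_le_of_measurable (hΩ : MeasurableSet Ω) (hr : Measurable r)
    (hpos : ∀ φ ∈ Ico 0 (2 * Real.pi), 0 < r φ) (hsub : starRegion O r ⊆ Ω) (ha : 0 ≤ a)
    (hb : b ≤ 2 * Real.pi) {g : Plane → ℝ≥0∞} (hg : Measurable g) :
    curvIntegral O r a b g ≤ 2 * ∫⁻ x in Ω, g x := by
  have hm := measurable_curvIntegrand (O := O) hr hg
  have hgi : Measurable (Ω.indicator g) := hg.indicator hΩ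
  have hab : Ico a b ⊆ Ico 0 (2 * Real.pi) := Ico_subset_Ico ha hb
  calc curvIntegral O r a b g
      = ∫⁻ ρ in Iio (0 : ℝ), ∫⁻ φ in Ico a b,
          g (curvilinear O r ρ φ) * ENNReal.ofReal (Real.exp (2 * ρ) * r φ ^ 2) := by
        rw [curvIntegral, Measure.restrict_congr_set Iio_ae_eq_Iic]
    _ = ∫⁻ φ in Ico a b, ∫⁻ ρ in Iio (0 : ℝ),
          g (curvilinear O r ρ φ) * ENNReal.ofReal (Real.exp (2 * ρ) * r φ ^ 2) :=
        lintegral_lintegral_swap hm.aemeasurable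
    _ = ∫⁻ φ in Ico a b, ∫⁻ s in Ioo 0 (r φ),
          ENNReal.ofReal s * Ω.indicator g (O + s • direction φ) := by
        refine setLIntegral_congr_fun measurableSet_Ico fun φ hφ => ?_
        have := lintegral_ray (hpos φ (hab hφ)) fun s => g (O + s • direction φ)
        simp only [curvilinear]
        rw [this]
        refine setLIntegral_congr_fun measurableSet_Ioo fun s hs => ?_
        rw [indicator_of_mem (hsub ⟨s, φ, hs.1.le, hs.2, hab hφ, rfl⟩)]
    _ ≤ ∫⁻ φ in Ico a b, ∫⁻ s in Ioi (0 : ℝ),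
          ENNReal.ofReal s * Ω.indicator g (O + s • direction φ) :=
        lintegral_mono fun φ => lintegral_mono_set fun s hs => hs.1
    _ ≤ ∫⁻ φ in Ico 0 (2 * Real.pi), ∫⁻ s in Ioi (0 : ℝ),
          ENNReal.ofReal s * Ω.indicator g (O + s • direction φ) := lintegral_mono_set hab
    _ ≤ 2 * ∫⁻ x in Ω, g x := by
        rw [← lintegral_indicator hΩ]
        exact lintegral_polar_le O hgi

/-- Null sets of `Ω` are not seen by integrals in curvilinear coordinates. -/
theorem curvIntegral_congr_of_measurable (hΩ : MeasurableSet Ω) (hr : Measurable r)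
    (hpos : ∀ φ ∈ Ico 0 (2 * Real.pi), 0 < r φ) (hsub : starRegion O r ⊆ Ω) (ha : 0 ≤ a)
    (hb : b ≤ 2 * Real.pi) {g g' : Plane → ℝ≥0∞} (h : g =ᵐ[volume.restrict Ω] g') :
    curvIntegral O r a b g = curvIntegral O r a b g' := by
  set N := toMeasurable (volume.restrict Ω) {x | ¬ g x = g' x} with hN
  have hN0 : volume.restrict Ω N = 0 := (measure_toMeasurable _).trans h
  have hNm : MeasurableSet N := measurableSet_toMeasurable _ _
  have h1m : Measurable (N.indicator (1 : Plane → ℝ≥0∞)) := measurable_one.indicator hNm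
  have h0 : curvIntegral O r a b (N.indicator 1) = 0 := by
    refine le_antisymm ((curvIntegral_le_of_measurable hΩ hr hpos hsub ha hb h1m).trans ?_) zero_le
    rw [lintegral_indicator_one hNm, hN0, mul_zero]
  rw [curvIntegral, lintegral_eq_zero_iff (measurable_lintegral_curvIntegrand hr h1m)] at h0
  refine lintegral_congr_ae ?_
  filter_upwards [h0] with ρ hρ
  rw [Pi.zero_apply, lintegral_eq_zero_iff (measurable_curvIntegrand_angle hr h1m ρ)] at hρ
  refine lintegral_congr_ae ?_
  filter_upwards [hρ, ae_restrict_mem measurableSet_Ico] with φ hφ hφm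
  have hrφ := hpos φ ⟨ha.trans hφm.1, hφm.2.trans_le hb⟩
  have hnot : curvilinear O r ρ φ ∉ N := by
    intro hmem
    have h1 : (0 : ℝ) < Real.exp (2 * ρ) * r φ ^ 2 := by positivity
    simp only [Pi.zero_apply, mul_eq_zero, indicator_of_mem hmem, Pi.one_apply, one_ne_zero,
      false_or, ENNReal.ofReal_eq_zero] at hφ
    exact absurd hφ (not_le.2 h1)
  have : g (curvilinear O r ρ φ) = g' (curvilinear O r ρ φ) := by
    by_contra hne
    exact hnot (subset_toMeasurable _ _ hne)
  rw [this]

/-- A continuous radius function on `[0, 2π]` agrees there with a measurable function. -/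
theorem exists_measurable_radius (hr : ContinuousOn r (Icc 0 (2 * Real.pi))) :
    ∃ r' : ℝ → ℝ, Measurable r' ∧ ∀ φ ∈ Icc 0 (2 * Real.pi), r φ = r' φ := by
  have h0 : (0 : ℝ) ≤ 2 * Real.pi := by positivity
  refine ⟨IccExtend h0 ((Icc 0 (2 * Real.pi)).domRestrict r), ?_, fun φ hφ => ?_⟩
  · exact (continuous_IccExtend_iff.2 (continuousOn_iff_continuous_domRestrict.1 hr)).measurable
  · rw [IccExtend_of_mem h0 _ hφ]; rfl

theorem curvIntegral_le (hΩ : MeasurableSet Ω) (hr : ContinuousOn r (Icc 0 (2 * Real.pi)))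
    (hpos : ∀ φ ∈ Icc 0 (2 * Real.pi), 0 < r φ) (hsub : starRegion O r ⊆ Ω) (ha : 0 ≤ a)
    (hb : b ≤ 2 * Real.pi)
    {g : Plane → ℝ≥0∞} (hg : AEMeasurable g (volume.restrict Ω)) :
    curvIntegral O r a b g ≤ 2 * ∫⁻ x in Ω, g x := by
  obtain ⟨r', hr', he⟩ := exists_measurable_radius hr
  have he' : ∀ φ ∈ Ico 0 (2 * Real.pi), r φ = r' φ := fun φ hφ => he φ (Ico_subset_Icc_self hφ)
  have hpos' : ∀ φ ∈ Ico 0 (2 * Real.pi), 0 < r' φ :=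
    fun φ hφ => he' φ hφ ▸ hpos φ (Ico_subset_Icc_self hφ)
  rw [starRegion_congr he'] at hsub
  rw [curvIntegral_congr_radius fun φ hφ => he' φ (Ico_subset_Ico ha hb hφ),
    curvIntegral_congr_of_measurable hΩ hr' hpos' hsub ha hb hg.ae_eq_mk,
    lintegral_congr_ae hg.ae_eq_mk]
  exact curvIntegral_le_of_measurable hΩ hr' hpos' hsub ha hb hg.measurable_mk

/-- Fatou's lemma in curvilinear coordinates. -/
theorem curvIntegral_le_liminf (hΩ : MeasurableSet Ω) (hr : ContinuousOn r (Icc 0 (2 * Real.pi)))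
    (hpos : ∀ φ ∈ Icc 0 (2 * Real.pi), 0 < r φ) (hsub : starRegion O r ⊆ Ω) (ha : 0 ≤ a)
    (hb : b ≤ 2 * Real.pi)
    {g : ℕ → Plane → ℝ≥0∞} {g₀ : Plane → ℝ≥0∞}
    (hg : ∀ n, AEMeasurable (g n) (volume.restrict Ω))
    (hlim : ∀ᵐ x ∂volume.restrict Ω, Tendsto (fun n => g n x) atTop (𝓝 (g₀ x))) :
    curvIntegral O r a b g₀ ≤ liminf (fun n => curvIntegral O r a b (g n)) atTop := by
  obtain ⟨r', hr', he⟩ := exists_measurable_radius hr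
  have he' : ∀ φ ∈ Ico 0 (2 * Real.pi), r φ = r' φ := fun φ hφ => he φ (Ico_subset_Icc_self hφ)
  have hpos' : ∀ φ ∈ Ico 0 (2 * Real.pi), 0 < r' φ :=
    fun φ hφ => he' φ hφ ▸ hpos φ (Ico_subset_Icc_self hφ)
  rw [starRegion_congr he'] at hsub
  have hab : ∀ φ ∈ Ico a b, r φ = r' φ := fun φ hφ => he' φ (Ico_subset_Ico ha hb hφ)
  have h0 : g₀ =ᵐ[volume.restrict Ω] fun x => liminf (fun n => (hg n).mk (g n) x) atTop := by
    filter_upwards [hlim, ae_all_iff.2 fun n => (hg n).ae_eq_mk] with x h1 h2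
    simp only [← h2]
    exact h1.liminf_eq.symm
  have hn : ∀ n, curvIntegral O r' a b (g n) = curvIntegral O r' a b ((hg n).mk (g n)) :=
    fun n => curvIntegral_congr_of_measurable hΩ hr' hpos' hsub ha hb (hg n).ae_eq_mk
  simp only [curvIntegral_congr_radius hab]
  rw [curvIntegral_congr_of_measurable hΩ hr' hpos' hsub ha hb h0]
  simp only [hn]
  have hin : ∀ ρ, ∫⁻ φ in Ico a b,
      liminf (fun n => (hg n).mk (g n) (curvilinear O r' ρ φ)) atTop
        * ENNReal.ofReal (Real.exp (2 * ρ) * r' φ ^ 2)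
      ≤ liminf (fun n => ∫⁻ φ in Ico a b, (hg n).mk (g n) (curvilinear O r' ρ φ)
        * ENNReal.ofReal (Real.exp (2 * ρ) * r' φ ^ 2)) atTop := by
    intro ρ
    refine le_trans (lintegral_mono fun φ => ?_) (lintegral_liminf_le fun n =>
      measurable_curvIntegrand_angle hr' (hg n).measurable_mk ρ)
    have h := ENNReal.le_liminf_mul (f := atTop)
      (u := fun n => (hg n).mk (g n) (curvilinear O r' ρ φ))
      (v := fun _ => ENNReal.ofReal (Real.exp (2 * ρ) * r' φ ^ 2))
    rwa [liminf_const] at h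
  exact (lintegral_mono hin).trans (lintegral_liminf_le fun n =>
    measurable_lintegral_curvIntegrand hr' (hg n).measurable_mk)

end

/-! ### Geometry of the star-shaped subdomains -/

section

variable {Ω : Set Plane} {O : Plane} {r : ℝ → ℝ} {K m : ℕ}

theorem AngularMesh.node_nonneg (M : AngularMesh m) (i : Fin (m + 1)) : 0 ≤ M.node i :=
  M.first ▸ M.strictMono.monotone (Fin.zero_le i)

theorem AngularMesh.node_le (M : AngularMesh m) (i : Fin (m + 1)) : M.node i ≤ 2 * Real.pi :=
  M.last ▸ M.strictMono.monotone (Fin.le_last i)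

theorem AngularMesh.exists_mem_Ico (M : AngularMesh m) {φ : ℝ} (h0 : 0 ≤ φ)
    (h1 : φ < 2 * Real.pi) : ∃ j : Fin m, φ ∈ Ico (M.node j.castSucc) (M.node j.succ) := by
  have key : ∀ i : Fin (m + 1), φ < M.node i →
      ∃ j : Fin m, φ ∈ Ico (M.node j.castSucc) (M.node j.succ) := by
    intro i
    induction i using Fin.induction with
    | zero => intro h; rw [M.first] at h; exact absurd h0 (not_le.2 h)
    | succ i ih =>
      intro h
      by_cases hi : φ < M.node i.castSucc
      · exact ih hi
      · exact ⟨i, not_lt.1 hi, h⟩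
  exact key (Fin.last m) (M.last ▸ h1)

/-- The closed region bounded by the curve `φ ↦ O + r(φ) (cos φ, sin φ)` is compact. -/
theorem isCompact_closedStar (hr : ContinuousOn r (Icc 0 (2 * Real.pi))) :
    IsCompact ((fun p : ℝ × ℝ => O + (p.1 * r p.2) • direction p.2) ''
      (Icc 0 1 ×ˢ Icc 0 (2 * Real.pi))) := by
  refine (isCompact_Icc.prod isCompact_Icc).image_of_continuousOn ?_
  have h1 : ContinuousOn (fun p : ℝ × ℝ => p.1 * r p.2) (Icc 0 1 ×ˢ Icc 0 (2 * Real.pi)) :=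
    continuous_fst.continuousOn.mul (hr.comp continuous_snd.continuousOn fun p hp => hp.2)
  exact continuousOn_const.add
    (h1.smul (continuous_direction.comp continuous_snd).continuousOn)

theorem closure_starRegion_subset (hr : ContinuousOn r (Icc 0 (2 * Real.pi)))
    (hpos : ∀ φ ∈ Icc 0 (2 * Real.pi), 0 < r φ) :
    closure (starRegion O r) ⊆ (fun p : ℝ × ℝ => O + (p.1 * r p.2) • direction p.2) ''
      (Icc 0 1 ×ˢ Icc 0 (2 * Real.pi)) := by
  refine closure_minimal ?_ (isCompact_closedStar hr).isClosed
  rintro x ⟨s, φ, hs, hsr, hφ, rfl⟩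
  have h := hpos φ (Ico_subset_Icc_self hφ)
  refine ⟨(s / r φ, φ), ⟨⟨by positivity, (div_le_one h).2 hsr.le⟩, Ico_subset_Icc_self hφ⟩, ?_⟩
  simp only
  rw [div_mul_cancel₀ _ h.ne']

/-- The curve `φ ↦ O + r(φ) (cos φ, sin φ)` is a null set, being the image of the graph of `r`
under the change from polar to Cartesian coordinates. -/
theorem volume_curve (hr : Measurable r) :
    volume {x | ∃ φ, x = O + r φ • direction φ} = 0 := by
  have hg : volume {p : ℝ × ℝ | p.2 = r p.1} = 0 := by
    have hm : MeasurableSet {p : ℝ × ℝ | p.2 = r p.1} :=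
      measurableSet_eq_fun measurable_snd (hr.comp measurable_fst)
    rw [Measure.volume_eq_prod, Measure.measure_prod_null hm]
    refine ae_of_all _ fun φ => ?_
    have : Prod.mk φ ⁻¹' {p : ℝ × ℝ | p.2 = r p.1} = {r φ} := rfl
    simp only [this, Pi.zero_apply, Real.volume_singleton]
  have hd : DifferentiableOn ℝ (fun p : ℝ × ℝ => (p.2 * Real.cos p.1, p.2 * Real.sin p.1))
      {p : ℝ × ℝ | p.2 = r p.1} := by fun_prop
  have him := addHaar_image_eq_zero_of_differentiableOn_of_addHaar_eq_zero volume hd hg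
  rw [← (measurePreserving_cartesian O).measure_preimage_equiv]
  refine measure_mono_null ?_ him
  rintro p ⟨φ, hφ⟩
  refine ⟨(φ, r φ), rfl, (cartesian O).injective ?_⟩
  rw [hφ]
  exact cartesian_polar O (r φ) φ

namespace StarDecomposition

variable (D : StarDecomposition Ω K) (mesh : Fin K → AngularMesh m)

theorem isBounded (D : StarDecomposition Ω K) : Bornology.IsBounded Ω := by
  refine Bornology.IsBounded.subset (Bornology.isBounded_iUnion.2 fun k => ?_) D.cover
  obtain ⟨r₀, h0, hr₀⟩ := D.radius_pos
  exact (isCompact_closedStar (D.radius_piecewiseC1 k).1).isBounded.subset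
    (closure_starRegion_subset (D.radius_piecewiseC1 k).1 fun φ hφ => h0.trans_le (hr₀ k φ hφ))

theorem radius_pos' (k : Fin K) : ∀ φ ∈ Icc 0 (2 * Real.pi), 0 < D.radius k φ := by
  obtain ⟨r₀, h0, hr₀⟩ := D.radius_pos
  exact fun φ hφ => h0.trans_le (hr₀ k φ hφ)

/-- The sectors exhaust `Ω` up to the singular points. -/
theorem ae_mem_sector (hΩ : IsOpen Ω) :
    ∀ᵐ x ∂volume.restrict Ω, ∃ k j, x ∈ sector D mesh k j := by
  have hne : ∀ᵐ x ∂volume.restrict Ω, x ∉ range D.center :=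
    measure_eq_zero_iff_ae_notMem.1 ((finite_range D.center).measure_zero _)
  filter_upwards [hne, ae_restrict_mem hΩ.measurableSet] with x hx hxΩ
  obtain ⟨k, hk⟩ := mem_iUnion.1 (D.cover hxΩ)
  obtain ⟨⟨t, φ⟩, ⟨⟨ht0, ht1⟩, hφ⟩, rfl⟩ :=
    closure_starRegion_subset (D.radius_piecewiseC1 k).1 (D.radius_pos' k) hk
  have ht : 0 < t := by
    refine lt_of_le_of_ne ht0 fun h => hx ⟨k, ?_⟩
    simp only at h ⊢
    simp [← h]
  -- the angle `2π` is the angle `0`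
  obtain ⟨ψ, hψ, hd, hrad⟩ : ∃ ψ ∈ Ico 0 (2 * Real.pi), direction ψ = direction φ ∧
      D.radius k ψ = D.radius k φ := by
    rcases hφ.2.eq_or_lt with h | h
    · refine ⟨0, ⟨le_rfl, by positivity⟩, ?_, ?_⟩
      · simp only at h
        rw [h, ← direction_add_two_pi 0, zero_add]
      · simp only at h
        rw [h, D.radius_closed k]
    · exact ⟨φ, ⟨hφ.1, h⟩, rfl, rfl⟩
  obtain ⟨j, hj⟩ := (mesh k).exists_mem_Ico hψ.1 hψ.2
  refine ⟨k, j, Real.log t, ψ, Real.log_nonpos ht0 ht1, hj, ?_⟩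
  rw [curvilinear, Real.exp_log ht, hd, hrad]

/-- Up to a null set the sectors lie in `Ω`. -/
theorem ae_mem_of_sector (k : Fin K) (j : Fin m) :
    sector D mesh k j ≤ᵐ[volume] Ω := by
  obtain ⟨r', hr', he⟩ := exists_measurable_radius (D.radius_piecewiseC1 k).1
  have h0 : volume {x | ∃ φ, x = D.center k + r' φ • direction φ} = 0 := volume_curve hr'
  filter_upwards [measure_eq_zero_iff_ae_notMem.1 h0] with x hx hxs
  obtain ⟨ρ, φ, hρ, hφ, rfl⟩ := hxs
  have hφ' : φ ∈ Ico 0 (2 * Real.pi) :=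
    ⟨((mesh k).node_nonneg _).trans hφ.1, hφ.2.trans_le ((mesh k).node_le _)⟩
  have hpos := D.radius_pos' k φ (Ico_subset_Icc_self hφ')
  refine D.subset k ⟨Real.exp ρ * D.radius k φ, φ, by positivity, ?_, hφ', rfl⟩
  have hne : ρ ≠ 0 := by
    rintro rfl
    exact hx ⟨φ, by rw [curvilinear, Real.exp_zero, one_mul, he φ (Ico_subset_Icc_self hφ')]⟩
  have := Real.exp_lt_one_iff.2 (lt_of_le_of_ne hρ hne)
  nlinarith

end StarDecomposition

end

/-! ### Total variation -/

section

variable {Ω : Set Plane} {C₁ C₂ : ℝ}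

/-- The classical divergence, as it occurs in the total variation. -/
def classicalDiv (w : Plane → Plane) (x : Plane) : ℝ :=
  ∑ i : Fin 2, classicalPartial i (fun y => w y i) x

theorem classicalPartial_apply_eq_zero {w : Plane → Plane} (i : Fin 2) {x : Plane} (hx : x ∉ tsupport w) :
    classicalPartial i (fun y => w y i) x = 0 := by
  have h1 : x ∉ tsupport fun y => w y i := by
    refine fun h => hx (closure_mono (fun y hy => ?_) h)
    intro h0
    exact hy (by simp [h0])
  have h2 : fderiv ℝ (fun y => w y i) x = 0 :=
    image_eq_zero_of_notMem_tsupport fun h => h1 (tsupport_fderiv_subset ℝ h)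
  simp [classicalPartial, h2]

namespace IsTVField

variable {w : Plane → Plane}

theorem contDiff_apply (hw : IsTVField Ω w) (i : Fin 2) : ContDiff ℝ 1 fun y => w y i :=
  (EuclideanSpace.proj i : Plane →L[ℝ] ℝ).contDiff.comp hw.1

theorem continuous_partial (hw : IsTVField Ω w) (i : Fin 2) :
    Continuous (classicalPartial i fun y => w y i) :=
  ((hw.contDiff_apply i).continuous_fderiv (by simp)).clm_apply continuous_const

theorem integrable_partial (hw : IsTVField Ω w) (i : Fin 2) :
    Integrable (classicalPartial i fun y => w y i) :=
  (hw.continuous_partial i).integrable_of_hasCompactSupport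
    (HasCompactSupport.intro hw.2.1 fun _ hx => classicalPartial_apply_eq_zero i hx)

theorem integral_partial (hw : IsTVField Ω w) (i : Fin 2) :
    ∫ x in Ω, classicalPartial i (fun y => w y i) x = 0 := by
  rw [setIntegral_eq_integral_of_forall_compl_eq_zero fun x hx =>
    classicalPartial_apply_eq_zero i fun h => hx (hw.2.2.1 h)]
  have h := integral_mul_fderiv_eq_neg_fderiv_mul_of_integrable (μ := (volume : Measure Plane))
    (f := fun _ : Plane => (1 : ℝ)) (g := fun y => w y i) (v := EuclideanSpace.single i (1 : ℝ))
    (by simp) (by simp only [one_mul]; exact hw.integrable_partial i)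
    (by
      simp only [one_mul]
      refine (hw.contDiff_apply i).continuous.integrable_of_hasCompactSupport
        (HasCompactSupport.intro hw.2.1 fun x hx => ?_)
      simp [image_eq_zero_of_notMem_tsupport hx])
    (fun x _ => by fun_prop) (fun x _ => (hw.contDiff_apply i).differentiable (by simp) x)
  simpa [classicalPartial] using h

theorem integrable_classicalDiv (hw : IsTVField Ω w) : Integrable (classicalDiv w) :=
  integrable_finsetSum _ fun i _ => hw.integrable_partial i

end IsTVField

theorem totalVariation_const (c : ℝ) : totalVariation Ω (fun _ => c) = 0 := by
  refine le_antisymm (iSup₂_le fun w hw => ?_) zero_le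
  rw [integral_const_mul,
    integral_finsetSum _ fun i _ => (hw.integrable_partial i).integrableOn]
  simp [hw.integral_partial]

/-- The total variation is lower semicontinuous under bounded pointwise convergence. -/
theorem totalVariation_le_liminf {a : ℕ → Plane → ℝ} {b : Plane → ℝ} {C : ℝ}
    (hm : ∀ n, AEStronglyMeasurable (a n) (volume.restrict Ω))
    (hC : ∀ n, ∀ᵐ x ∂volume.restrict Ω, |a n x| ≤ C)
    (hlim : ∀ᵐ x ∂volume.restrict Ω, Tendsto (fun n => a n x) atTop (𝓝 (b x))) :
    totalVariation Ω b ≤ liminf (fun n => totalVariation Ω (a n)) atTop := by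
  refine iSup₂_le fun w hw => ?_
  have hd := hw.integrable_classicalDiv.integrableOn (s := Ω)
  have ht : Tendsto (fun n => ∫ x in Ω, a n x * classicalDiv w x) atTop
      (𝓝 (∫ x in Ω, b x * classicalDiv w x)) := by
    refine tendsto_integral_of_dominated_convergence (fun x => C * |classicalDiv w x|)
      (fun n => (hm n).mul hd.1) (hd.abs.const_mul C) (fun n => ?_) ?_
    · filter_upwards [hC n] with x hx
      rw [norm_mul, Real.norm_eq_abs, Real.norm_eq_abs]
      gcongr
    · filter_upwards [hlim] with x hx
      exact hx.mul_const _
  calc ENNReal.ofReal (∫ x in Ω, b x * classicalDiv w x)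
      = liminf (fun n => ENNReal.ofReal (∫ x in Ω, a n x * classicalDiv w x)) atTop :=
        (ENNReal.tendsto_ofReal ht).liminf_eq.symm
    _ ≤ liminf (fun n => totalVariation Ω (a n)) atTop :=
        liminf_le_liminf (Eventually.of_forall fun n =>
          le_iSup₂ (f := fun w (_ : IsTVField Ω w) =>
            ENNReal.ofReal (∫ x in Ω, a n x * classicalDiv w x)) w hw)

/-! ### Piecewise constant coefficients -/

variable {K m : ℕ} {D : StarDecomposition Ω K} {mesh : Fin K → AngularMesh m}

theorem const_mem_discreteAdmissible (hC : C₁ ≤ C₂) :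
    ((fun _ => C₁, fun _ => C₁) : LamePair) ∈ discreteAdmissible D mesh C₁ C₂ := by
  refine ⟨⟨memLp_top_const _, memLp_top_const _, ?_, ?_, ?_, ?_⟩, fun k j => ⟨⟨C₁, ?_⟩, ⟨C₁, ?_⟩⟩⟩
  · exact ae_of_all _ fun _ => ⟨le_rfl, hC⟩
  · exact ae_of_all _ fun _ => ⟨le_rfl, hC⟩
  · rw [totalVariation_const]; exact ENNReal.zero_lt_top
  · rw [totalVariation_const]; exact ENNReal.zero_lt_top
  · exact ae_of_all _ fun _ => rfl
  · exact ae_of_all _ fun _ => rfl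

/-- The constant on a sector can be chosen in `[C₁, C₂]`. This uses that the sector lies in `Ω` up
to a null set; on a sector of measure zero the constant is arbitrary. -/
theorem exists_const_mem_Icc (hC : C₁ ≤ C₂) {a : Plane → ℝ}
    (h : ∀ᵐ x ∂volume.restrict Ω, a x ∈ Icc C₁ C₂) {k : Fin K} {j : Fin m}
    (hc : ∃ c : ℝ, ∀ᵐ x ∂volume.restrict (sector D mesh k j), a x = c) :
    ∃ c ∈ Icc C₁ C₂, ∀ᵐ x ∂volume.restrict (sector D mesh k j), a x = c := by
  obtain ⟨c, hc⟩ := hc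
  rcases eq_zero_or_neZero (volume.restrict (sector D mesh k j)) with h0 | h0
  · exact ⟨C₁, ⟨le_rfl, hC⟩, by simp [h0]⟩
  · have hle : volume.restrict (sector D mesh k j) ≤ volume.restrict Ω :=
      Measure.restrict_mono' (D.ae_mem_of_sector mesh k j) le_rfl
    obtain ⟨x, hx1, hx2⟩ := (hc.and (ae_mono hle h)).exists
    exact ⟨c, hx1 ▸ hx2, hc⟩

/-- Convergence of the constants on the sectors yields uniform convergence of the coefficients to
a limit that is again constant on the sectors. -/
theorem exists_limit_coeff (hΩ : IsOpen Ω) {a : ℕ → Plane → ℝ} {c : ℕ → Fin K → Fin m → ℝ}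
    {c₀ : Fin K → Fin m → ℝ}
    (ha : ∀ n k j, ∀ᵐ x ∂volume.restrict (sector D mesh k j), a n x = c n k j)
    (hc : Tendsto c atTop (𝓝 c₀)) :
    ∃ b : Plane → ℝ, (∀ k j, ∀ᵐ x ∂volume.restrict (sector D mesh k j), b x = c₀ k j) ∧
      (∀ n, ∀ᵐ x ∂volume.restrict Ω, |a n x - b x| ≤ dist (c n) c₀) ∧
      ∀ᵐ x ∂volume.restrict Ω, Tendsto (fun n => a n x) atTop (𝓝 (b x)) := by
  have hckj : ∀ k j, Tendsto (fun n => c n k j) atTop (𝓝 (c₀ k j)) := fun k j =>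
    tendsto_pi_nhds.1 (tendsto_pi_nhds.1 hc k) j
  set b : Plane → ℝ := fun x => limUnder atTop fun n => a n x with hb
  have hbk : ∀ k j, ∀ᵐ x ∂volume.restrict (sector D mesh k j), b x = c₀ k j := by
    intro k j
    filter_upwards [ae_all_iff.2 fun n => ha n k j] with x hx
    simp only [hb, hx]
    exact (hckj k j).limUnder_eq
  have hall : ∀ᵐ x ∂volume.restrict Ω, ∃ k j, (∀ n, a n x = c n k j) ∧ b x = c₀ k j := by
    have h1 : ∀ᵐ x ∂volume, ∀ n k j, x ∈ sector D mesh k j → a n x = c n k j :=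
      ae_all_iff.2 fun n => ae_all_iff.2 fun k => ae_all_iff.2 fun j =>
        ae_imp_of_ae_restrict (ha n k j)
    have h2 : ∀ᵐ x ∂volume, ∀ k j, x ∈ sector D mesh k j → b x = c₀ k j :=
      ae_all_iff.2 fun k => ae_all_iff.2 fun j => ae_imp_of_ae_restrict (hbk k j)
    filter_upwards [D.ae_mem_sector mesh hΩ, ae_restrict_of_ae h1, ae_restrict_of_ae h2]
      with x ⟨k, j, hx⟩ e1 e2
    exact ⟨k, j, fun n => e1 n k j hx, e2 k j hx⟩
  refine ⟨b, hbk, fun n => ?_, ?_⟩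
  · filter_upwards [hall] with x ⟨k, j, h1, h2⟩
    rw [h1, h2, ← Real.dist_eq]
    exact (dist_le_pi_dist (c n k) (c₀ k) j).trans (dist_le_pi_dist (c n) c₀ k)
  · filter_upwards [hall] with x ⟨k, j, h1, h2⟩
    simp only [h1, h2]
    exact hckj k j

/-! ### The discrete functional -/

variable {f z : Plane → Plane} {η : ℝ} {ℓ : LamePair}

/-- The misfit integral over the sector `(k, j)`. -/
def misfit (D : StarDecomposition Ω K) (mesh : Fin K → AngularMesh m) (f z : Plane → Plane)
    (ℓ : LamePair) (k : Fin K) (j : Fin m) : ℝ≥0∞ :=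
  curvIntegral (D.center k) (D.radius k) ((mesh k).node j.castSucc) ((mesh k).node j.succ)
    fun x => ENNReal.ofReal (energyDensity Ω ℓ (fun x => displacement Ω f ℓ x - z x) x)

theorem discreteEnergy_eq : discreteEnergy D mesh η f z ℓ =
    2⁻¹ * (∑ k : Fin K, ∑ j : Fin m, misfit D mesh f z ℓ k j)
      + ENNReal.ofReal η * (totalVariation Ω ℓ.1 + totalVariation Ω ℓ.2) := by
  have h : ∀ (x : ℝ) (ρ s : ℝ), ENNReal.ofReal (x * (Real.exp (2 * ρ) * s ^ 2))
      = ENNReal.ofReal x * ENNReal.ofReal (Real.exp (2 * ρ) * s ^ 2) :=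
    fun x ρ s => ENNReal.ofReal_mul' (by positivity)
  simp only [discreteEnergy, misfit, curvIntegral, h]

theorem discreteEnergy_lt_top (hΩ : IsOpen Ω) (hC₁ : 0 < C₁) (hf : MemH1Vec Ω f)
    (hz : MemH1Vec Ω z) (hℓ : ℓ ∈ admissible Ω C₁ C₂) : discreteEnergy D mesh η f z ℓ < ⊤ := by
  have hI := integrable_energyDensity hℓ
    ((displacement_spec hΩ D.isBounded hC₁ hf hℓ).1.sub hz)
  have hmis : ∀ k j, misfit D mesh f z ℓ k j < ⊤ := by
    intro k j
    refine (curvIntegral_le hΩ.measurableSet (D.radius_piecewiseC1 k).1 (D.radius_pos' k)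
      (D.subset k) ((mesh k).node_nonneg _) ((mesh k).node_le _)
      hI.aemeasurable.ennreal_ofReal).trans_lt ?_
    exact ENNReal.mul_lt_top (by simp) hI.lintegral_lt_top
  rw [discreteEnergy_eq]
  refine ENNReal.add_lt_top.2 ⟨ENNReal.mul_lt_top (by simp) ?_,
    ENNReal.mul_lt_top ENNReal.ofReal_lt_top (ENNReal.add_lt_top.2 ⟨hℓ.2.2.2.2.1, hℓ.2.2.2.2.2⟩)⟩
  exact ENNReal.sum_lt_top.2 fun k _ => ENNReal.sum_lt_top.2 fun j _ => hmis k j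

theorem liminf_add_le_liminf_add (u v : ℕ → ℝ≥0∞) :
    liminf u atTop + liminf v atTop ≤ liminf (fun n => u n + v n) atTop := by
  have hmono : ∀ u : ℕ → ℝ≥0∞, Monotone fun n => ⨅ i, u (i + n) := by
    intro u n p hnp
    refine le_iInf fun i => (iInf_le _ (i + (p - n))).trans_eq ?_
    congr 1
    omega
  simp only [liminf_eq_iSup_iInf_of_nat']
  rw [ENNReal.iSup_add_iSup_of_monotone (hmono u) (hmono v)]
  exact iSup_mono fun n => le_iInf fun i => add_le_add (iInf_le _ i) (iInf_le _ i)

theorem sum_liminf_le_liminf_sum {ι : Type*} (s : Finset ι) (u : ι → ℕ → ℝ≥0∞) :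
    ∑ i ∈ s, liminf (u i) atTop ≤ liminf (fun n => ∑ i ∈ s, u i n) atTop := by
  classical
  induction s using Finset.induction_on with
  | empty => simp
  | insert i s hi ih =>
    simp only [Finset.sum_insert hi]
    exact (add_le_add_right ih _).trans (liminf_add_le_liminf_add _ _)

theorem const_mul_liminf_le (c : ℝ≥0∞) (u : ℕ → ℝ≥0∞) :
    c * liminf u atTop ≤ liminf (fun n => c * u n) atTop := by
  have h := ENNReal.le_liminf_mul (f := atTop) (u := fun _ : ℕ => c) (v := u)
  rwa [liminf_const] at h

/-- Lower semicontinuity of the functional: along a subsequence, its value at a limit of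
coefficients is at most the lower limit of the values. -/
theorem exists_subseq_discreteEnergy_le (hΩ : IsOpen Ω) (hC₁ : 0 < C₁)
    (hf : MemH1Vec Ω f) (hz : MemH1Vec Ω z) {L : ℕ → LamePair}
    (hL : ∀ n, L n ∈ admissible Ω C₁ C₂) (hℓ : ℓ ∈ admissible Ω C₁ C₂) {δ : ℕ → ℝ}
    (hδ : Tendsto δ atTop (𝓝 0))
    (h1 : ∀ n, ∀ᵐ x ∂volume.restrict Ω, |(L n).1 x - ℓ.1 x| ≤ δ n)
    (h2 : ∀ n, ∀ᵐ x ∂volume.restrict Ω, |(L n).2 x - ℓ.2 x| ≤ δ n)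
    (ht1 : totalVariation Ω ℓ.1 ≤ liminf (fun n => totalVariation Ω (L n).1) atTop)
    (ht2 : totalVariation Ω ℓ.2 ≤ liminf (fun n => totalVariation Ω (L n).2) atTop) :
    ∃ φ : ℕ → ℕ, StrictMono φ ∧ discreteEnergy D mesh η f z ℓ
      ≤ liminf (fun n => discreteEnergy D mesh η f z (L (φ n))) atTop := by
  obtain ⟨φ, hφ, hlim⟩ := exists_subseq_energyDensity hΩ D.isBounded hC₁ hf hz hL hℓ hδ h1 h2
  refine ⟨φ, hφ, ?_⟩
  have hmis : ∀ k j, misfit D mesh f z ℓ k j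
      ≤ liminf (fun n => misfit D mesh f z (L (φ n)) k j) atTop := by
    intro k j
    refine curvIntegral_le_liminf hΩ.measurableSet (D.radius_piecewiseC1 k).1 (D.radius_pos' k)
      (D.subset k) ((mesh k).node_nonneg _) ((mesh k).node_le _) (fun n => ?_) ?_
    · exact (integrable_energyDensity (hL (φ n)) ((displacement_spec hΩ D.isBounded hC₁ hf
        (hL (φ n))).1.sub hz)).aemeasurable.ennreal_ofReal
    · filter_upwards [hlim] with x hx
      exact ENNReal.tendsto_ofReal hx
  have hsub : ∀ u : ℕ → ℝ≥0∞, liminf u atTop ≤ liminf (fun n => u (φ n)) atTop := fun u =>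
    liminf_le_liminf_of_le hφ.tendsto_atTop
  simp only [discreteEnergy_eq]
  refine le_trans (add_le_add ?_ ?_) (liminf_add_le_liminf_add _ _)
  · refine le_trans (mul_le_mul_right ?_ _) (const_mul_liminf_le _ _)
    refine le_trans (Finset.sum_le_sum fun k _ => ?_) (sum_liminf_le_liminf_sum _ _)
    exact (Finset.sum_le_sum fun j _ => hmis k j).trans (sum_liminf_le_liminf_sum _ _)
  · refine le_trans (mul_le_mul_right ?_ _) (const_mul_liminf_le _ _)
    exact (add_le_add (ht1.trans (hsub _)) (ht2.trans (hsub _))).trans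
      (liminf_add_le_liminf_add _ _)

end

/-! ### Existence of a minimizer -/

theorem exists_minimizer {K m : ℕ} {Ω : Set Plane} (hΩ : IsOpen Ω)
    (D : StarDecomposition Ω K) (mesh : Fin K → AngularMesh m) {C₁ C₂ η : ℝ} (hC₁ : 0 < C₁)
    (hC : C₁ ≤ C₂) (hη : 0 < η) {f z : Plane → Plane} (hf : MemH1Vec Ω f) (hz : MemH1Vec Ω z) :
    ∃ ℓ₀ ∈ discreteAdmissible D mesh C₁ C₂, ∀ ℓ ∈ discreteAdmissible D mesh C₁ C₂,
      discreteEnergy D mesh η f z ℓ₀ ≤ discreteEnergy D mesh η f z ℓ := by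
  have hconst := const_mem_discreteAdmissible (D := D) (mesh := mesh) hC
  set S := discreteEnergy D mesh η f z '' discreteAdmissible D mesh C₁ C₂ with hS
  have hne : S.Nonempty := ⟨_, mem_image_of_mem _ hconst⟩
  have hinf : sInf S < ⊤ := (sInf_le (mem_image_of_mem _ hconst)).trans_lt
    (discreteEnergy_lt_top hΩ hC₁ hf hz hconst.1)
  obtain ⟨u, -, hu, huS⟩ := exists_seq_tendsto_sInf hne (OrderBot.bddBelow S)
  choose ℓ hℓ hℓu using huS
  -- the constants on the sectors lie in a compact set, so that those of a subsequence converge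
  choose c hcI hc using fun n k j => exists_const_mem_Icc hC (hℓ n).1.2.2.1 ((hℓ n).2 k j).1
  choose d hdI hd using fun n k j => exists_const_mem_Icc hC (hℓ n).1.2.2.2.1 ((hℓ n).2 k j).2
  have hcpt : IsCompact (univ.pi fun _ : Fin K => univ.pi fun _ : Fin m => Icc C₁ C₂) :=
    isCompact_univ_pi fun _ => isCompact_univ_pi fun _ => isCompact_Icc
  obtain ⟨⟨c₀, d₀⟩, -, φ, hφ, hlim⟩ := (hcpt.prod hcpt).tendsto_subseq
    (x := fun n => (c n, d n)) fun n =>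
      ⟨fun k _ j _ => hcI n k j, fun k _ j _ => hdI n k j⟩
  obtain ⟨hc₀, hd₀⟩ : Tendsto (fun n => c (φ n)) atTop (𝓝 c₀) ∧
      Tendsto (fun n => d (φ n)) atTop (𝓝 d₀) :=
    ⟨(continuous_fst.tendsto _).comp hlim, (continuous_snd.tendsto _).comp hlim⟩
  obtain ⟨a, ha, had, hat⟩ := exists_limit_coeff (D := D) (mesh := mesh) hΩ
    (a := fun n => (ℓ (φ n)).1) (fun n => hc (φ n)) hc₀
  obtain ⟨b, hb, hbd, hbt⟩ := exists_limit_coeff (D := D) (mesh := mesh) hΩ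
    (a := fun n => (ℓ (φ n)).2) (fun n => hd (φ n)) hd₀
  have haI : ∀ᵐ x ∂volume.restrict Ω, a x ∈ Icc C₁ C₂ := by
    filter_upwards [hat, ae_all_iff.2 fun n => (hℓ (φ n)).1.2.2.1] with x h1 h2
    exact isClosed_Icc.mem_of_tendsto h1 (Eventually.of_forall h2)
  have hbI : ∀ᵐ x ∂volume.restrict Ω, b x ∈ Icc C₁ C₂ := by
    filter_upwards [hbt, ae_all_iff.2 fun n => (hℓ (φ n)).1.2.2.2.1] with x h1 h2
    exact isClosed_Icc.mem_of_tendsto h1 (Eventually.of_forall h2)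
  have hbound : ∀ {t : ℝ}, t ∈ Icc C₁ C₂ → |t| ≤ C₂ := fun {t} ht =>
    abs_le.2 ⟨by linarith [ht.1, ht.2], ht.2⟩
  have hta := totalVariation_le_liminf (fun n => (hℓ (φ n)).1.1.1)
    (fun n => (hℓ (φ n)).1.2.2.1.mono fun x hx => hbound hx) hat
  have htb := totalVariation_le_liminf (fun n => (hℓ (φ n)).1.2.1.1)
    (fun n => (hℓ (φ n)).1.2.2.2.1.mono fun x hx => hbound hx) hbt
  -- the energies bound the total variations, so that the limit has finite total variation
  have hJ : Tendsto (fun n => discreteEnergy D mesh η f z (ℓ (φ n))) atTop (𝓝 (sInf S)) := by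
    simp only [hℓu]
    exact hu.comp hφ.tendsto_atTop
  have hη' : ENNReal.ofReal η ≠ 0 := by simpa using hη
  have htv : ∀ n, totalVariation Ω (ℓ (φ n)).1 + totalVariation Ω (ℓ (φ n)).2
      ≤ (ENNReal.ofReal η)⁻¹ * discreteEnergy D mesh η f z (ℓ (φ n)) := by
    intro n
    rw [← ENNReal.mul_le_iff_le_inv hη' ENNReal.ofReal_ne_top, discreteEnergy_eq]
    exact le_add_self
  have hJη := ENNReal.Tendsto.const_mul (a := (ENNReal.ofReal η)⁻¹) hJ
    (Or.inr (ENNReal.inv_ne_top.2 hη'))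
  have hfin : (ENNReal.ofReal η)⁻¹ * sInf S < ⊤ :=
    ENNReal.mul_lt_top (ENNReal.inv_lt_top.2 (pos_iff_ne_zero.2 hη')) hinf
  have hta' : totalVariation Ω a < ⊤ :=
    (hta.trans ((liminf_le_liminf (Eventually.of_forall fun n =>
      le_self_add.trans (htv n))).trans_eq hJη.liminf_eq)).trans_lt hfin
  have htb' : totalVariation Ω b < ⊤ :=
    (htb.trans ((liminf_le_liminf (Eventually.of_forall fun n =>
      le_add_self.trans (htv n))).trans_eq hJη.liminf_eq)).trans_lt hfin
  have hab : ((a, b) : LamePair) ∈ discreteAdmissible D mesh C₁ C₂ := by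
    refine ⟨⟨?_, ?_, haI, hbI, hta', htb'⟩, fun k j => ⟨⟨_, ha k j⟩, ⟨_, hb k j⟩⟩⟩
    · exact memLp_top_of_bound (aestronglyMeasurable_of_tendsto_ae atTop
        (fun n => (hℓ (φ n)).1.1.1) hat) C₂ (haI.mono fun x hx => hbound hx)
    · exact memLp_top_of_bound (aestronglyMeasurable_of_tendsto_ae atTop
        (fun n => (hℓ (φ n)).1.2.1.1) hbt) C₂ (hbI.mono fun x hx => hbound hx)
  have hδ : Tendsto (fun n => dist (c (φ n)) c₀ + dist (d (φ n)) d₀) atTop (𝓝 0) := by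
    simpa using (tendsto_iff_dist_tendsto_zero.1 hc₀).add (tendsto_iff_dist_tendsto_zero.1 hd₀)
  obtain ⟨ψ, hψ, hle⟩ := exists_subseq_discreteEnergy_le (D := D) (mesh := mesh) (η := η) hΩ hC₁ hf
    hz (fun n => (hℓ (φ n)).1) hab.1 hδ
    (fun n => (had n).mono fun x hx => hx.trans (le_add_of_nonneg_right dist_nonneg))
    (fun n => (hbd n).mono fun x hx => hx.trans (le_add_of_nonneg_left dist_nonneg)) hta htb
  refine ⟨(a, b), hab, fun ℓ' hℓ' => ?_⟩
  calc discreteEnergy D mesh η f z (a, b)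
      ≤ liminf (fun n => discreteEnergy D mesh η f z (ℓ (φ (ψ n)))) atTop := hle
    _ = sInf S := (hJ.comp hψ.tendsto_atTop).liminf_eq
    _ ≤ discreteEnergy D mesh η f z ℓ' := sInf_le (mem_image_of_mem _ hℓ')

end

end LameInverse

theorem theorem3p2 {K m : ℕ} (Ω : Set Plane) (hΩ : IsOpen Ω) (hΩc : IsConnected Ω)
    (D : LameInverse.StarDecomposition Ω K) (mesh : Fin K → LameInverse.AngularMesh m)
    (C₁ C₂ η : ℝ) (hC₁ : 0 < C₁) (hC : C₁ ≤ C₂) (hη : 0 < η)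
    (f z : Plane → Plane) (hf : LameInverse.MemH1Vec Ω f) (hz : LameInverse.MemH1Vec Ω z) :
    -- the displacement `u[ℓ]` is well defined for every discrete pair of coefficients
    (∀ ℓ ∈ LameInverse.discreteAdmissible D mesh C₁ C₂,
      ∃ u, LameInverse.IsWeakSolution Ω ℓ f u ∧
        ∀ u', LameInverse.IsWeakSolution Ω ℓ f u' → u' =ᵐ[volume.restrict Ω] u) ∧
    -- the discrete functional has finite values on the discrete set and attains its minimum there
    (∀ ℓ ∈ LameInverse.discreteAdmissible D mesh C₁ C₂,
      LameInverse.discreteEnergy D mesh η f z ℓ < ⊤) ∧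
    ∃ ℓ₀ ∈ LameInverse.discreteAdmissible D mesh C₁ C₂,
      ∀ ℓ ∈ LameInverse.discreteAdmissible D mesh C₁ C₂,
        LameInverse.discreteEnergy D mesh η f z ℓ₀ ≤ LameInverse.discreteEnergy D mesh η f z ℓ := by
  refine ⟨fun ℓ hℓ => ?_, fun ℓ hℓ => ?_, ?_⟩
  · obtain ⟨u, hu⟩ := LameInverse.exists_isWeakSolution hΩ D.isBounded hC₁ hf hℓ.1
    exact ⟨u, hu, fun u' hu' => hu.ae_eq hΩ D.isBounded hC₁ hf hℓ.1 hu'⟩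
  · exact LameInverse.discreteEnergy_lt_top hΩ hC₁ hf hz hℓ.1
  · exact LameInverse.exists_minimizer hΩ D mesh hC₁ hC hη hf hz
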